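/- Let $d\ge 2$, let $B\subset\mathbb{R}^{d-1}$ be compact with non-empty interior, let $X=B\times[0,+\infty)$, and let $Y\subset\mathbb{R}^d$ be non-empty and compact. Let $c:X\times Y\to[0,+\infty)$ be a cost function such that: (A) $c$ is locally Lipschitz; (B) for all $s\in B$ and $y\in Y$ the function $t\mapsto c((s,t),y)$ is strictly increasing and unbounded on $[0,+\infty)$; (C) the family $\{c((\cdot,t),y):B\to[0,+\infty)\mid t\in[0,+\infty),\,y\in Y\}$ is equicontinuous. Let $\mathcal{P}_{\mathrm{ac}}(B)$ be the set of Borel probability measures on $B$ that are absolutely continuous with respect to Lebesgue measure, each identified with its density. For $p\in\mathcal{P}_{\mathrm{ac}}(B)$ let $\mu_p$ be the $d$-dimensional Lebesgue measure restricted to $\{(s,t)\in X: t\le p(s)\}$. Let $\nu$ be a Borel probability measure on $Y$. Define the primal functional $F_\nu:\mathcal{P}_{\mathrm{ac}}(B)\to[0,+\infty]$ by $$F_\nu(p)=\mathcal{T}_c(\mu_p,\nu)=\inf_{\gamma}\int_{X\times Y}c\,\mathrm{d}\gamma,$$ where the infimum is over all probability measures $\gamma$ on $X\times Y$ with marginals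 $\mu_p$ and $\nu$. For $\psi\in C(Y)$ (the continuous real functions on $Y$) let $\psi^c(x)=\inf_{y\in Y}\{c(x,y)-\psi(y)\}$, and define $$K(\psi;\mu_p,\nu)=\int_X\psi^c\,\mathrm{d}\mu_p+\int_Y\psi\,\mathrm{d}\nu\in(-\infty,+\infty],\qquad G_\nu(\psi)=\inf_{p\in\mathcal{P}_{\mathrm{ac}}(B)}K(\psi;\mu_p,\nu).$$ A function $\psi\in C(Y)$ is a Kantorovich potential from $\mu_p$ to $\nu$ if it maximises $K(\cdot\,;\mu_p,\nu)$ over $C(Y)$. For $s\in B$, $y\in Y$, $\sigma\in\mathbb{R}$ let $q(s,y,\sigma)$ be the unique $t\ge 0$ with $c((s,t),y)=\sigma$ if $\sigma\ge c((s,0),y)$, and let $q(s,y,\sigma)=0$ otherwise. Then the following hold. 1. There is a unique minimiser of $F_\nu$ over $\mathcal{P}_{\mathrm{ac}}(B)$, and it has a continuous density. 2. The minimum of $F_\nu$ and the maximum of $G_\nu$ are attained, finite and equal: $$\min_{p\in\mathcal{P}_{\mathrm{ac}}(B)}F_\nu(p)=\max_{\psi\in C(Y)}G_\nu(\psi).$$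 3. For each $\psi\in C(Y)$ there is a unique $\tau_\psi\in\mathbb{R}$ such that $p_\psi(s)=\max_{y\in Y}q(s,y,\psi(y)+\tau_\psi)$ is a probability density on $B$; and for all $p\in\mathcal{P}_{\mathrm{ac}}(B)$ and $\psi\in C(Y)$, the measure $p$ minimises $F_\nu$ and $\psi$ maximises $G_\nu$ if and only if $p=p_\psi$ and $\psi$ is a Kantorovich potential from $\mu_p$ to $\nu$. -/

import Mathlib

open MeasureTheory Set
open scoped NNReal ENNReal

noncomputable section

namespace FreeSurface

section Kantorovich

variable {X Y : Type*}

/-- The integral of a real function `f` with values in `[-∞, +∞]`, namely the integral of the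
positive part minus the integral of the negative part. It is meaningful when at least one of the
two is finite, in particular for a function that is bounded below and a finite measure. -/
def extIntegral [MeasurableSpace X] (f : X → ℝ) (μ : Measure X) : EReal :=
  ((∫⁻ x, ENNReal.ofReal (f x) ∂μ : ℝ≥0∞) : EReal) -
    ((∫⁻ x, ENNReal.ofReal (-f x) ∂μ : ℝ≥0∞) : EReal)

/-- The admissible transport plans from `μ` to `ν`: the probability measures on `X × Y` with
marginals `μ` and `ν`. -/
def transportPlans [MeasurableSpace X] [MeasurableSpace Y] (μ : Measure X) (ν : Measure Y) :
    Set (Measure (X × Y)) :=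
  {γ | IsProbabilityMeasure γ ∧ γ.map Prod.fst = μ ∧ γ.map Prod.snd = ν}

/-- The optimal transport cost from `μ` to `ν`, with values in `[0, +∞]`. -/
def transportCost [MeasurableSpace X] [MeasurableSpace Y] (c : X → Y → ℝ≥0)
    (μ : Measure X) (ν : Measure Y) : ℝ≥0∞ :=
  ⨅ γ ∈ transportPlans μ ν, ∫⁻ z, (c z.1 z.2 : ℝ≥0∞) ∂γ

/-- The `c`-transform `ψᶜ(x) = inf_y (c(x, y) - ψ(y))`. -/
def cTransform (c : X → Y → ℝ≥0) (ψ : Y → ℝ) (x : X) : ℝ :=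
  ⨅ y : Y, ((c x y : ℝ) - ψ y)

/-- The Kantorovich functional `K(ψ; μ, ν) = ∫ ψᶜ dμ + ∫ ψ dν`. For compact `Y`, a continuous `ψ`
is bounded and `ψᶜ` is bounded below, so that the first integral has a value in `(-∞, +∞]`. -/
def kantorovich [MeasurableSpace X] [MeasurableSpace Y] [TopologicalSpace Y] (c : X → Y → ℝ≥0)
    (μ : Measure X) (ν : Measure Y) (ψ : C(Y, ℝ)) : EReal :=
  extIntegral (cTransform c ψ) μ + ((∫ y, ψ y ∂ν : ℝ) : EReal)

/-- `ψ` is a Kantorovich potential from `μ` to `ν`: it maximises the Kantorovich functional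
over the continuous functions on `Y`. -/
def IsKantorovichPotential [MeasurableSpace X] [MeasurableSpace Y] [TopologicalSpace Y]
    (c : X → Y → ℝ≥0) (μ : Measure X) (ν : Measure Y) (ψ : C(Y, ℝ)) : Prop :=
  ∀ φ : C(Y, ℝ), kantorovich c μ ν φ ≤ kantorovich c μ ν ψ

end Kantorovich

section Surface

variable {m n : ℕ}

/-- The standing assumptions on a cost function `c : X × Y → [0, +∞)`, where
`X = B × [0, +∞)`. -/
structure IsAdmissibleCost {B : Set (EuclideanSpace ℝ (Fin m))}
    {Y : Set (EuclideanSpace ℝ (Fin n))} (c : B × ℝ≥0 → Y → ℝ≥0) : Prop where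
  locallyLipschitz : LocallyLipschitz (fun z : (B × ℝ≥0) × Y => c z.1 z.2)
  strictMono : ∀ (s : B) (y : Y), StrictMono (fun t : ℝ≥0 => c (s, t) y)
  unbounded : ∀ (s : B) (y : Y), ¬ BddAbove (range (fun t : ℝ≥0 => c (s, t) y))
  equicontinuous : Equicontinuous (fun (i : ℝ≥0 × Y) (s : B) => c (s, i.1) i.2)

/-- The `m`-dimensional Lebesgue measure on `B ⊆ ℝᵐ`. -/
def lebB (B : Set (EuclideanSpace ℝ (Fin m))) : Measure B :=
  (volume : Measure (EuclideanSpace ℝ (Fin m))).comap Subtype.val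

/-- The `(m + 1)`-dimensional Lebesgue measure on `X = B × [0, +∞)`: the product of the Lebesgue
measures on `B` and on `[0, +∞)`. -/
def lebX (B : Set (EuclideanSpace ℝ (Fin m))) : Measure (B × ℝ≥0) :=
  (lebB B).prod ((volume : Measure ℝ).comap ((↑) : ℝ≥0 → ℝ))

/-- The Borel probability measures on `B` that are absolutely continuous with respect to the
Lebesgue measure. -/
def ProbAC (B : Set (EuclideanSpace ℝ (Fin m))) : Type :=
  {ρ : Measure B // IsProbabilityMeasure ρ ∧ ρ ≪ lebB B}

variable {B : Set (EuclideanSpace ℝ (Fin m))} {Y : Set (EuclideanSpace ℝ (Fin n))}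

/-- The Lebesgue density of an absolutely continuous probability measure on `B`. -/
def ProbAC.density (p : ProbAC B) (s : B) : ℝ≥0 :=
  (p.1.rnDeriv (lebB B) s).toNNReal

/-- The measure `μ_p`: the Lebesgue measure restricted to `{(s, t) ∈ B × [0, +∞) : t ≤ p(s)}`. -/
def sourceMeasure (p : ProbAC B) : Measure (B × ℝ≥0) :=
  (lebX B).restrict {x | x.2 ≤ p.density x.1}

/-- The primal functional `F_ν(p) = T_c(μ_p, ν)`, with values in `[0, +∞]`. -/
def primal (c : B × ℝ≥0 → Y → ℝ≥0) (ν : Measure Y) (p : ProbAC B) : ℝ≥0∞ :=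
  transportCost c (sourceMeasure p) ν

/-- The dual functional `G_ν(ψ) = inf_p K(ψ; μ_p, ν)`. -/
def dual (c : B × ℝ≥0 → Y → ℝ≥0) (ν : Measure Y) (ψ : C(Y, ℝ)) : EReal :=
  ⨅ p : ProbAC B, kantorovich c (sourceMeasure p) ν ψ

/-- `p` minimises the primal functional. -/
def IsPrimalOptimal (c : B × ℝ≥0 → Y → ℝ≥0) (ν : Measure Y) (p : ProbAC B) : Prop :=
  ∀ p' : ProbAC B, primal c ν p ≤ primal c ν p'

/-- `ψ` maximises the dual functional. -/
def IsDualOptimal (c : B × ℝ≥0 → Y → ℝ≥0) (ν : Measure Y) (ψ : C(Y, ℝ)) : Prop :=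
  ∀ ψ' : C(Y, ℝ), dual c ν ψ' ≤ dual c ν ψ

open Classical in
/-- The function `q(s, y, σ)`: the inverse of `c((s, ·), y)` at `σ` if `σ ≥ c((s, 0), y)`, and
`0` otherwise. -/
def level (c : B × ℝ≥0 → Y → ℝ≥0) (s : B) (y : Y) (σ : ℝ) : ℝ≥0 :=
  if (c (s, 0) y : ℝ) ≤ σ then Function.invFun (fun t : ℝ≥0 => (c (s, t) y : ℝ)) σ else 0

/-- The function `s ↦ max_y q(s, y, ψ(y) + τ)`. -/
def levelMax (c : B × ℝ≥0 → Y → ℝ≥0) (ψ : C(Y, ℝ)) (τ : ℝ) (s : B) : ℝ≥0 :=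
  ⨆ y : Y, level c s y (ψ y + τ)

/-- The constant `τ` normalises `ψ` if `s ↦ max_y q(s, y, ψ(y) + τ)` is a probability density. -/
def IsNormalising (c : B × ℝ≥0 → Y → ℝ≥0) (ψ : C(Y, ℝ)) (τ : ℝ) : Prop :=
  ∫⁻ s, (levelMax c ψ τ s : ℝ≥0∞) ∂(lebB B) = 1

/-- The density `p_ψ(s) = max_y q(s, y, ψ(y) + τ_ψ)`, where `τ_ψ` is the normalising constant. -/
def optimalSurface (c : B × ℝ≥0 → Y → ℝ≥0) (ψ : C(Y, ℝ)) : B → ℝ≥0 :=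
  levelMax c ψ (Classical.epsilon (IsNormalising c ψ))

/-- The function `f` is a Lebesgue density of `p`. -/
def ProbAC.HasDensity (p : ProbAC B) (f : B → ℝ≥0) : Prop :=
  p.1 = (lebB B).withDensity (fun s => (f s : ℝ≥0∞))

end Surface

end FreeSurface

end

/-! For fixed `ψ`, minimising `∫ ψᶜ dμ_p` over `p` is a bathtub problem: among sets of measure one,
a sublevel set `{ψᶜ ≤ τ}` of measure one is optimal. Since `ψᶜ` is continuous and strictly
increasing in the height, this sublevel set is, up to a null set, the region below `p_ψ`
(`le_levelMax_iff`), and the level sets of `ψᶜ` are null, so the minimiser is unique (`bathtub_eq`).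
Hence `G_ν(ψ) = K(ψ; μ_{p_ψ}, ν)`, which is `dualReal`.

The dual functional has a maximiser (`exists_dualReal_max`): the surfaces `p_ψ` share a height
bound, so a double `c`-transform over a compact slab improves any `ψ` to one with a fixed modulus of
continuity, and Arzelà–Ascoli applies. Perturbing a maximiser `ψ` along segments, with `K` concave
in the potential and `p_ψ` varying continuously, shows that `ψ` is a Kantorovich potential for its
own surface (`isKantorovichPotential_of_forall_dualReal_le`).

Kantorovich duality then gives `F_ν(p_ψ) = G_ν(ψ)`, while weak duality gives `G_ν ≤ F_ν` throughout.
So there is no gap, and any optimal `p` attains the infimum defining `G_ν(ψ)`, whence `p = p_ψ` by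
the equality case of the bathtub principle. -/

noncomputable section

namespace FreeSurface

/-! ### Kantorovich duality on compact spaces. -/

section Duality

set_option linter.unusedSectionVars false

variable {X Y : Type*} [MetricSpace X] [CompactSpace X] [SecondCountableTopology X]
  [MeasurableSpace X] [BorelSpace X] [MetricSpace Y] [CompactSpace Y] [SecondCountableTopology Y]
  [MeasurableSpace Y] [BorelSpace Y]

lemma integrable_continuousMap (μ : Measure X) [IsFiniteMeasure μ] (f : C(X, ℝ)) :
    Integrable f μ :=
  (map_continuous f).integrable_of_hasCompactSupport (HasCompactSupport.of_compactSpace f)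

lemma integral_add_integral_nonneg (μ : Measure X) (ν : Measure Y) [IsProbabilityMeasure μ]
    [IsProbabilityMeasure ν] (f : C(X, ℝ)) (g : C(Y, ℝ)) (h : ∀ x y, 0 ≤ f x + g y) :
    0 ≤ ∫ x, f x ∂μ + ∫ y, g y ∂ν := by
  have h1 (y : Y) : 0 ≤ ∫ x, f x ∂μ + g y := by
    have := integral_nonneg (μ := μ) (f := fun x => f x + g y) (fun x => h x y)
    rw [integral_add (integrable_continuousMap μ f) (integrable_const _)] at this
    simpa using this
  have := integral_nonneg (μ := ν) (f := fun y => ∫ x, f x ∂μ + g y) h1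
  rw [integral_add (integrable_const _) (integrable_continuousMap ν g)] at this
  simpa using this

/-- The function `(x, y) ↦ f x + g y`. -/
def sumMap : C(X, ℝ) × C(Y, ℝ) →ₗ[ℝ] C(X × Y, ℝ) where
  toFun p := p.1.comp ContinuousMap.fst + p.2.comp ContinuousMap.snd
  map_add' p q := by ext; simp; ring
  map_smul' a p := by ext; simp

@[simp] lemma sumMap_apply (f : C(X, ℝ)) (g : C(Y, ℝ)) (z : X × Y) :
    sumMap (f, g) z = f z.1 + g z.2 := rfl

/-- The functional `(f, g, a) ↦ ∫ f dμ + ∫ g dν + a v`. -/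
def marginalFunctional (μ : Measure X) (ν : Measure Y) [IsProbabilityMeasure μ]
    [IsProbabilityMeasure ν] (v : ℝ) : (C(X, ℝ) × C(Y, ℝ)) × ℝ →ₗ[ℝ] ℝ where
  toFun p := ∫ x, p.1.1 x ∂μ + ∫ y, p.1.2 y ∂ν + p.2 * v
  map_add' p q := by
    simp [integral_add (integrable_continuousMap μ _) (integrable_continuousMap μ _),
      integral_add (integrable_continuousMap ν _) (integrable_continuousMap ν _)]
    ring
  map_smul' a p := by
    simp [integral_const_mul]
    ring

/-- The convex cone of all `((f, g, a), h)` with `0 ≤ a` and `0 ≤ f ⊕ g + a c + h`. -/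
def costCone (c : C(X × Y, ℝ)) :
    PointedCone ℝ (((C(X, ℝ) × C(Y, ℝ)) × ℝ) × C(X × Y, ℝ)) where
  carrier := {p | 0 ≤ p.1.2 ∧ ∀ z, 0 ≤ sumMap p.1.1 z + p.1.2 * c z + p.2 z}
  add_mem' := by
    rintro p q ⟨hp, hp'⟩ ⟨hq, hq'⟩
    refine ⟨add_nonneg hp hq, fun z => ?_⟩
    have h1 := hp' z
    have h2 := hq' z
    simp only [Prod.fst_add, Prod.snd_add, map_add, ContinuousMap.add_apply]
    linarith
  zero_mem' := by simp
  smul_mem' := by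
    rintro a p ⟨hp, hp'⟩
    refine ⟨mul_nonneg a.2 hp, fun z => ?_⟩
    have h1 := mul_nonneg a.2 (hp' z)
    have h2 : sumMap (a • p).1.1 z = (a : ℝ) * sumMap p.1.1 z := by
      have : (a • p).1.1 = (a : ℝ) • p.1.1 := rfl
      rw [this, map_smul]; rfl
    have h3 : (a • p).1.2 = (a : ℝ) * p.1.2 := rfl
    have h4 : (a • p).2 z = (a : ℝ) * p.2 z := rfl
    rw [h2, h3, h4]
    have : (a : ℝ) * sumMap p.1.1 z + a * p.1.2 * c z + a * p.2 z =
      (a : ℝ) * (sumMap p.1.1 z + p.1.2 * c z + p.2 z) := by ring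
    rw [this]; exact h1

/-- M. Riesz extension of `marginalFunctional` from the subspace `h = 0`, with positivity measured
by `costCone`. The scalar coordinate stands for multiples of `c`; giving it the weight `v` is what
forces `L c ≤ v`. -/
lemma exists_positive_functional (c : C(X × Y, ℝ)) (μ : Measure X) (ν : Measure Y)
    [IsProbabilityMeasure μ] [IsProbabilityMeasure ν] (v : ℝ)
    (hv : ∀ (f : C(X, ℝ)) (g : C(Y, ℝ)), (∀ x y, f x + g y ≤ c (x, y)) →
      ∫ x, f x ∂μ + ∫ y, g y ∂ν ≤ v) :
    ∃ L : C(X × Y, ℝ) →ₗ[ℝ] ℝ, (∀ h, (∀ z, 0 ≤ h z) → 0 ≤ L h) ∧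
      (∀ f g, L (sumMap (f, g)) = ∫ x, f x ∂μ + ∫ y, g y ∂ν) ∧ L c ≤ v := by
  let E := ((C(X, ℝ) × C(Y, ℝ)) × ℝ) × C(X × Y, ℝ)
  let ℓ : E →ₗ.[ℝ] ℝ :=
    { domain := LinearMap.ker (LinearMap.snd ℝ ((C(X, ℝ) × C(Y, ℝ)) × ℝ) C(X × Y, ℝ))
      toFun := (marginalFunctional μ ν v ∘ₗ LinearMap.fst ℝ _ _) ∘ₗ Submodule.subtype _ }
  have hℓ (x : ℓ.domain) : ℓ x = marginalFunctional μ ν v (x : E).1 := rfl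
  obtain ⟨L, hL, hpos⟩ := riesz_extension (costCone c) ℓ
    (by
      rintro ⟨⟨⟨⟨f, g⟩, a⟩, h⟩, hx⟩ hs
      obtain rfl : h = 0 := hx
      obtain ⟨ha, hs⟩ := hs
      rw [hℓ]
      change 0 ≤ ∫ x, f x ∂μ + ∫ y, g y ∂ν + a * v
      change 0 ≤ a at ha
      have hs' (x y) : 0 ≤ f x + g y + a * c (x, y) := by simpa using hs (x, y)
      rcases ha.eq_or_lt with rfl | ha
      · simpa using integral_add_integral_nonneg μ ν f g (by simpa using hs')
      -- Division by `-a` turns membership in the cone into admissibility of `(-f/a, -g/a)` for the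
      -- dual problem.
      · have := hv ((-a⁻¹) • f) ((-a⁻¹) • g) (fun x y => by
          have h2 : 0 ≤ a⁻¹ * (f x + g y + a * c (x, y)) :=
            mul_nonneg (by positivity) (hs' x y)
          have h3 : a⁻¹ * (f x + g y + a * c (x, y)) =
              a⁻¹ * f x + a⁻¹ * g y + c (x, y) := by field_simp
          simp only [ContinuousMap.smul_apply, smul_eq_mul]
          linarith)
        simp only [ContinuousMap.smul_apply, smul_eq_mul, integral_const_mul] at this
        have h4 : 0 ≤ a * (v + a⁻¹ * ∫ x, f x ∂μ + a⁻¹ * ∫ y, g y ∂ν) :=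
          mul_nonneg ha.le (by linarith)
        have h5 : a * (v + a⁻¹ * ∫ x, f x ∂μ + a⁻¹ * ∫ y, g y ∂ν) =
            ∫ x, f x ∂μ + ∫ y, g y ∂ν + a * v := by field_simp; ring
        linarith)
    (by
      rintro ⟨⟨⟨f, g⟩, a⟩, h⟩
      -- The witness cancels `f`, `g` and `a` and leaves the constant `‖h‖`, which dominates `-h`.
      refine ⟨⟨(((ContinuousMap.const _ ‖h‖ - f, - g), -a), 0), rfl⟩, ?_, ?_⟩
      · simp
      · intro z
        have := (abs_le.1 (h.norm_coe_le_norm z)).1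
        simp
        linarith)
  have hL' (p) : L (p, 0) = marginalFunctional μ ν v p := hL ⟨(p, 0), rfl⟩
  have hsplit (p : (C(X, ℝ) × C(Y, ℝ)) × ℝ) (h : C(X × Y, ℝ)) :
      L (p, h) = marginalFunctional μ ν v p + L (0, h) := by
    rw [← hL', ← map_add]; simp
  have hneg (h : C(X × Y, ℝ)) : L (0, -h) = -L (0, h) := by
    rw [← map_neg, Prod.neg_mk, neg_zero]
  refine ⟨L ∘ₗ LinearMap.inr ℝ _ _, fun h hh => hpos _ ⟨le_rfl, by simpa using hh⟩,
    fun f g => ?_, ?_⟩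
  -- The cone contains both elements with opposite signs, so positivity gives the two inequalities
  -- of an equality.
  · have h1 := hpos (((f, g), 0), -sumMap (f, g)) ⟨le_rfl, by simp⟩
    have h2 := hpos (((-f, -g), 0), sumMap (f, g)) ⟨le_rfl, fun z => by simp; linarith⟩
    rw [hsplit] at h1 h2
    rw [hneg] at h1
    simp [marginalFunctional, integral_neg] at h1 h2 ⊢
    linarith
  · have h1 := hpos (((0, 0), 1), -c) ⟨zero_le_one, by simp⟩
    rw [hsplit] at h1
    rw [hneg] at h1
    simp [marginalFunctional] at h1 ⊢
    linarith

/-- **Kantorovich duality** on compact spaces: an upper bound for the dual problem bounds the cost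
of some transport plan. -/
theorem exists_plan_of_dual_le (c : C(X × Y, ℝ)) (μ : Measure X) (ν : Measure Y)
    [IsProbabilityMeasure μ] [IsProbabilityMeasure ν] (v : ℝ)
    (hv : ∀ (f : C(X, ℝ)) (g : C(Y, ℝ)), (∀ x y, f x + g y ≤ c (x, y)) →
      ∫ x, f x ∂μ + ∫ y, g y ∂ν ≤ v) :
    ∃ γ ∈ transportPlans μ ν, ∫ z, c z ∂γ ≤ v := by
  obtain ⟨L, hpos, hmar, hc⟩ := exists_positive_functional c μ ν v hv
  let L' : CompactlySupportedContinuousMap (X × Y) ℝ →ₚ[ℝ] ℝ :=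
    PositiveLinearMap.mk₀
      { toFun := fun f => L f.toContinuousMap
        map_add' := fun f g => map_add L f.toContinuousMap g.toContinuousMap
        map_smul' := fun a f => map_smul L a f.toContinuousMap }
      (fun f hf => hpos _ hf)
  let γ := RealRMK.rieszMeasure L'
  have hγ (h : C(X × Y, ℝ)) : ∫ z, h z ∂γ = L h :=
    RealRMK.integral_rieszMeasure L' ⟨h, HasCompactSupport.of_compactSpace h⟩
  have hfst : γ.map Prod.fst = μ := by
    refine ext_of_forall_integral_eq_of_IsFiniteMeasure fun f => ?_
    rw [integral_map measurable_fst.aemeasurable (by fun_prop)]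
    simpa [hmar] using hγ (sumMap (f.toContinuousMap, 0))
  have hsnd : γ.map Prod.snd = ν := by
    refine ext_of_forall_integral_eq_of_IsFiniteMeasure fun f => ?_
    rw [integral_map measurable_snd.aemeasurable (by fun_prop)]
    simpa [hmar] using hγ (sumMap (0, f.toContinuousMap))
  refine ⟨γ, ⟨⟨?_⟩, hfst, hsnd⟩, (hγ c).trans_le hc⟩
  have : (γ.map Prod.fst) univ = 1 := by rw [hfst]; exact measure_univ
  rwa [Measure.map_apply measurable_fst MeasurableSet.univ, preimage_univ] at this

end Duality

/-! ### The bathtub principle. -/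

section Bathtub

variable {X : Type*} [MeasurableSpace X] {μ : Measure X} {D E : Set X} {f : X → ℝ} {τ : ℝ}

/-- `f - τ` is nonpositive on `E` and positive off it. Integrated over two sets of measure one, the
constant `τ` cancels. -/
lemma bathtub_ae_le (hE : ∀ᵐ x ∂μ, x ∈ E ↔ f x ≤ τ) :
    E.indicator (fun x => f x - τ) ≤ᵐ[μ] D.indicator (fun x => f x - τ) := by
  filter_upwards [hE] with x hx
  by_cases h1 : x ∈ E <;> by_cases h2 : x ∈ D <;> simp [h1, h2] <;> grind

lemma setIntegral_sub_const (hD : μ D = 1) (hf : IntegrableOn f D μ) :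
    ∫ x in D, (f x - τ) ∂μ = ∫ x in D, f x ∂μ - τ := by
  have : IsFiniteMeasure (μ.restrict D) := ⟨by simp [hD]⟩
  rw [integral_sub hf (integrable_const _)]
  simp [Measure.real, hD]

/-- The bathtub principle. -/
lemma bathtub_le (hDm : MeasurableSet D) (hEm : MeasurableSet E) (hD : μ D = 1) (hE1 : μ E = 1)
    (hfD : IntegrableOn f D μ) (hfE : IntegrableOn f E μ) (hE : ∀ᵐ x ∂μ, x ∈ E ↔ f x ≤ τ) :
    ∫ x in E, f x ∂μ ≤ ∫ x in D, f x ∂μ := by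
  have hcD : IntegrableOn (fun _ => τ) D μ := integrableOn_const (by simp [hD])
  have hcE : IntegrableOn (fun _ => τ) E μ := integrableOn_const (by simp [hE1])
  have := integral_mono_ae ((integrable_indicator_iff hEm).2 (hfE.sub hcE))
    ((integrable_indicator_iff hDm).2 (hfD.sub hcD)) (bathtub_ae_le hE)
  simp only [Pi.sub_def] at this
  rw [integral_indicator hEm, integral_indicator hDm, setIntegral_sub_const hD hfD,
    setIntegral_sub_const hE1 hfE] at this
  linarith

/-- The equality case of the bathtub principle. -/
lemma bathtub_eq (hDm : MeasurableSet D) (hEm : MeasurableSet E) (hD : μ D = 1) (hE1 : μ E = 1)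
    (hfD : IntegrableOn f D μ) (hfE : IntegrableOn f E μ) (hE : ∀ᵐ x ∂μ, x ∈ E ↔ f x ≤ τ)
    (hne : ∀ᵐ x ∂μ, f x ≠ τ) (h : ∫ x in D, f x ∂μ ≤ ∫ x in E, f x ∂μ) : D =ᵐ[μ] E := by
  have hcD : IntegrableOn (fun _ => τ) D μ := integrableOn_const (by simp [hD])
  have hcE : IntegrableOn (fun _ => τ) E μ := integrableOn_const (by simp [hE1])
  have heq : ∫ x, E.indicator (fun x => f x - τ) x ∂μ =
      ∫ x, D.indicator (fun x => f x - τ) x ∂μ := by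
    rw [integral_indicator hEm, integral_indicator hDm, setIntegral_sub_const hD hfD,
      setIntegral_sub_const hE1 hfE, le_antisymm h (bathtub_le hDm hEm hD hE1 hfD hfE hE)]
  have := (integral_eq_iff_of_ae_le ((integrable_indicator_iff hEm).2 (hfE.sub hcE))
    ((integrable_indicator_iff hDm).2 (hfD.sub hcD)) (bathtub_ae_le hE)).1 heq
  filter_upwards [this, hne] with x hx hx'
  have h0 : f x - τ ≠ 0 := sub_ne_zero.2 hx'
  by_cases h1 : x ∈ E <;> by_cases h2 : x ∈ D <;> simp_all [indicator] <;>
    first | exact iff_of_true h2 h1 | exact iff_of_false h2 h1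

end Bathtub

/-! ### The `c`-transform and its sublevel sets. -/

section Transform

variable {m n : ℕ} {B : Set (EuclideanSpace ℝ (Fin m))} {Y : Set (EuclideanSpace ℝ (Fin n))}
  {c : B × ℝ≥0 → Y → ℝ≥0}

lemma IsAdmissibleCost.continuous (hc : IsAdmissibleCost c) :
    Continuous (fun z : (B × ℝ≥0) × Y => (c z.1 z.2 : ℝ)) :=
  NNReal.continuous_coe.comp hc.locallyLipschitz.continuous

/-- Monotonicity in the height makes the open cover of `B × Y` directed, so compactness yields a
single height. -/
lemma IsAdmissibleCost.exists_height [CompactSpace B] [CompactSpace Y] (hc : IsAdmissibleCost c)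
    (R : ℝ) : ∃ T : ℝ≥0, ∀ t, T ≤ t → ∀ s y, R < c (s, t) y := by
  have hcont := hc.continuous
  obtain ⟨T, hT⟩ := isCompact_univ.elim_directed_cover
    (fun t : ℝ≥0 => {z : B × Y | R < (c (z.1, t) z.2 : ℝ)})
    (fun t => isOpen_lt continuous_const
      (hcont.comp (f := fun z : B × Y => ((z.1, t), z.2)) (by fun_prop)))
    (fun z _ => by
      have := hc.unbounded z.1 z.2
      rw [not_bddAbove_iff] at this
      obtain ⟨_, ⟨t, rfl⟩, ht⟩ := this R.toNNReal
      exact mem_iUnion.2 ⟨t, (Real.le_coe_toNNReal R).trans_lt (NNReal.coe_lt_coe.2 ht)⟩)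
    (directed_of_isDirected_le fun t t' htt' z (hz : R < _) =>
      hz.trans_le (NNReal.coe_le_coe.2 ((hc.strictMono z.1 z.2).monotone htt')))
  exact ⟨T, fun t ht s y => (hT (mem_univ (s, y)) : R < (c (s, T) y : ℝ)).trans_le
    (NNReal.coe_le_coe.2 ((hc.strictMono s y).monotone ht))⟩

lemma IsAdmissibleCost.exists_bound [CompactSpace B] [CompactSpace Y] (hc : IsAdmissibleCost c)
    (t : ℝ≥0) : ∃ R : ℝ, ∀ s y, (c (s, t) y : ℝ) ≤ R := by
  obtain ⟨R, hR⟩ := (isCompact_range (f := fun z : B × Y => (c (z.1, t) z.2 : ℝ))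
    (hc.continuous.comp (f := fun z : B × Y => ((z.1, t), z.2)) (by fun_prop))).bddAbove
  exact ⟨R, fun s y => hR ⟨(s, y), rfl⟩⟩

variable [CompactSpace Y] (ψ : C(Y, ℝ))

lemma bddBelow_cost_sub (x : B × ℝ≥0) : BddBelow (range fun y : Y => (c x y : ℝ) - ψ y) := by
  refine ⟨-‖ψ‖, ?_⟩
  rintro _ ⟨y, rfl⟩
  have h1 := (abs_le.1 (ψ.norm_coe_le_norm y)).2
  change -‖ψ‖ ≤ (c x y : ℝ) - ψ y
  linarith [(c x y).coe_nonneg]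

lemma cTransform_le (x : B × ℝ≥0) (y : Y) : cTransform c ψ x ≤ c x y - ψ y :=
  ciInf_le (bddBelow_cost_sub ψ x) y

variable [Nonempty Y]

omit [CompactSpace Y] in
variable {ψ} in
lemma le_cTransform {x : B × ℝ≥0} {a : ℝ} (h : ∀ y, a ≤ c x y - ψ y) : a ≤ cTransform c ψ x :=
  le_ciInf h

lemma neg_norm_le_cTransform (x : B × ℝ≥0) : -‖ψ‖ ≤ cTransform c ψ x :=
  le_cTransform fun y => by
    linarith [(abs_le.1 (ψ.norm_coe_le_norm y)).2, (c x y).coe_nonneg]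

lemma cTransform_le_add_norm (φ : C(Y, ℝ)) (x : B × ℝ≥0) :
    cTransform c ψ x ≤ cTransform c φ x + ‖ψ - φ‖ := by
  rw [← sub_le_iff_le_add]
  refine le_cTransform fun y => ?_
  have h1 := (abs_le.1 ((ψ - φ).norm_coe_le_norm y)).1
  rw [ContinuousMap.sub_apply] at h1
  linarith [cTransform_le (c := c) ψ x y]

lemma cTransform_concave (φ : C(Y, ℝ)) {a : ℝ} (ha : 0 ≤ a) (ha' : a ≤ 1) (x : B × ℝ≥0) :
    (1 - a) * cTransform c ψ x + a * cTransform c φ x ≤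
      cTransform c ((1 - a) • ψ + a • φ : C(Y, ℝ)) x := by
  refine le_cTransform fun y => ?_
  have h1 := mul_le_mul_of_nonneg_left (cTransform_le (c := c) ψ x y) (sub_nonneg.2 ha')
  have h2 := mul_le_mul_of_nonneg_left (cTransform_le (c := c) φ x y) ha
  simp only [ContinuousMap.add_apply, ContinuousMap.smul_apply, smul_eq_mul]
  linarith

variable (hc : IsAdmissibleCost c)
include hc

lemma exists_cTransform_eq (x : B × ℝ≥0) : ∃ y, cTransform c ψ x = c x y - ψ y := by
  have hcont : Continuous fun y : Y => (c x y : ℝ) - ψ y :=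
    (hc.continuous.comp (f := fun y : Y => (x, y)) (by fun_prop)).sub (map_continuous ψ)
  obtain ⟨y, -, hy⟩ := isCompact_univ.exists_isMinOn univ_nonempty hcont.continuousOn
  exact ⟨y, le_antisymm (cTransform_le ψ x y) (le_cTransform fun y' => hy (mem_univ y'))⟩

omit [Nonempty Y] in
lemma continuous_cTransform : Continuous (cTransform c ψ : B × ℝ≥0 → ℝ) := by
  have := (isCompact_univ (X := Y)).continuous_sInf
    (f := fun (x : B × ℝ≥0) (y : Y) => (c x y : ℝ) - ψ y)
    (hc.continuous.sub ((map_continuous ψ).comp continuous_snd))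
  simp only [image_univ] at this
  exact this

lemma cTransform_strictMono (s : B) : StrictMono fun t : ℝ≥0 => cTransform c ψ (s, t) := by
  intro t t' h
  obtain ⟨y, hy⟩ := exists_cTransform_eq ψ hc (s, t')
  have h1 : (c (s, t) y : ℝ) < c (s, t') y := NNReal.coe_lt_coe.2 (hc.strictMono s y h)
  change cTransform c ψ (s, t) < cTransform c ψ (s, t')
  linarith [cTransform_le (c := c) ψ (s, t) y]

omit [CompactSpace Y] [Nonempty Y] in
lemma level_surjective (s : B) (y : Y) {σ : ℝ} (hσ : (c (s, 0) y : ℝ) ≤ σ) :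
    ∃ t : ℝ≥0, (c (s, t) y : ℝ) = σ := by
  have hcont : Continuous fun t : ℝ≥0 => (c (s, t) y : ℝ) :=
    hc.continuous.comp (f := fun t : ℝ≥0 => ((s, t), y)) (by fun_prop)
  have := hc.unbounded s y
  rw [not_bddAbove_iff] at this
  obtain ⟨_, ⟨t, rfl⟩, ht⟩ := this σ.toNNReal
  exact mem_range_of_exists_le_of_exists_ge hcont ⟨0, hσ⟩
    ⟨t, ((Real.le_coe_toNNReal σ).trans_lt (NNReal.coe_lt_coe.2 ht)).le⟩

-- Positivity of `t` matters: at `t = 0` the left side always holds, also when `level` takes its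
-- default value `0`.
omit [CompactSpace Y] [Nonempty Y] in
lemma le_level_iff (s : B) (y : Y) (σ : ℝ) {t : ℝ≥0} (ht : 0 < t) :
    t ≤ level c s y σ ↔ (c (s, t) y : ℝ) ≤ σ := by
  unfold level
  split_ifs with h
  · have h1 : (c (s, Function.invFun (fun t : ℝ≥0 => (c (s, t) y : ℝ)) σ) y : ℝ) = σ :=
      Function.invFun_eq (f := fun t : ℝ≥0 => (c (s, t) y : ℝ)) (level_surjective hc s y h)
    conv_rhs => rw [← h1]
    rw [NNReal.coe_le_coe, (hc.strictMono s y).le_iff_le]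
  · refine ⟨fun h' => absurd h' (not_le.2 ht), fun h' => absurd ?_ h⟩
    exact (NNReal.coe_le_coe.2 ((hc.strictMono s y).monotone ht.le)).trans h'

variable [CompactSpace B]

/-- The link between surfaces and potentials: away from the base `t = 0`, the region below the
surface is a sublevel set of the `c`-transform. -/
lemma le_levelMax_iff (s : B) (τ : ℝ) {t : ℝ≥0} (ht : 0 < t) :
    t ≤ levelMax c ψ τ s ↔ cTransform c ψ (s, t) ≤ τ := by
  -- Needed because an unbounded supremum in `ℝ≥0` defaults to `0`.
  have hbdd : BddAbove (range fun y : Y => level c s y (ψ y + τ)) := by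
    obtain ⟨T, hT⟩ := hc.exists_height (‖ψ‖ + τ)
    refine ⟨T + 1, ?_⟩
    rintro _ ⟨y, rfl⟩
    by_contra! h
    have h1 := (le_level_iff hc s y _ (by positivity)).1 h.le
    linarith [hT (T + 1) (by simp) s y, (abs_le.1 (ψ.norm_coe_le_norm y)).2]
  constructor
  · intro h
    by_contra! hlt
    have hcont : Continuous fun t : ℝ≥0 => cTransform c ψ (s, t) :=
      (continuous_cTransform ψ hc).comp (by fun_prop)
    -- By continuity the excess over `τ` persists at some `t' < t`. That `t'` bounds every level, so
    -- the supremum stays strictly below `t`.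
    have hev : ∀ᶠ t' in nhdsWithin t (Iio t), τ < cTransform c ψ (s, t') :=
      (hcont.continuousAt.eventually (lt_mem_nhds hlt)).filter_mono nhdsWithin_le_nhds
    have : (nhdsWithin t (Iio t)).NeBot := nhdsLT_neBot_of_exists_lt ⟨0, ht⟩
    have hev2 : ∀ᶠ t' in nhdsWithin t (Iio t), 0 < t' :=
      (lt_mem_nhds ht).filter_mono nhdsWithin_le_nhds
    obtain ⟨t', ⟨ht1, ht0⟩, ht2⟩ := ((hev.and hev2).and self_mem_nhdsWithin).exists
    have : levelMax c ψ τ s ≤ t' := by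
      refine ciSup_le fun y => ?_
      by_contra! hy
      have := (le_level_iff hc s y _ ht0).1 hy.le
      linarith [cTransform_le (c := c) ψ (s, t') y]
    exact absurd (h.trans this) (not_le.2 ht2)
  · intro h
    obtain ⟨y, hy⟩ := exists_cTransform_eq ψ hc (s, t)
    refine le_trans ?_ (le_ciSup hbdd y)
    rw [le_level_iff hc s y _ ht]
    linarith

lemma levelMax_lt_iff (s : B) (τ : ℝ) {t : ℝ≥0} (ht : 0 < t) :
    levelMax c ψ τ s < t ↔ τ < cTransform c ψ (s, t) := by
  rw [← not_le, le_levelMax_iff ψ hc s τ ht, not_le]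

/-- Preimages of open rays are expressed through strict inequalities for the continuous
`cTransform`. For upper rays, strict monotonicity in the height makes the inequality strict at a
slightly lower height. -/
lemma continuous_levelMax_uncurry :
    Continuous fun z : ℝ × B => levelMax c ψ z.1 z.2 := by
  have hcont := continuous_cTransform ψ hc
  refine OrderTopology.continuous_iff.2 fun a => ⟨?_, ?_⟩
  · have : (fun z : ℝ × B => levelMax c ψ z.1 z.2) ⁻¹' Ioi a =
        ⋃ t ∈ Ioi a, {z : ℝ × B | cTransform c ψ (z.2, t) < z.1} := by
      ext ⟨τ, s⟩
      simp only [mem_preimage, mem_Ioi, mem_iUnion, mem_ofPred_eq, exists_prop]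
      constructor
      · intro h
        obtain ⟨t, h1, h2⟩ := exists_between h
        have h3 := (le_levelMax_iff ψ hc s τ (h1.bot_lt.trans h2)).1 le_rfl
        exact ⟨t, h1, (cTransform_strictMono ψ hc s h2).trans_le h3⟩
      · rintro ⟨t, h1, h2⟩
        exact h1.trans_le ((le_levelMax_iff ψ hc s τ h1.bot_lt).2 h2.le)
    rw [this]
    exact isOpen_biUnion fun t _ => isOpen_lt
      (hcont.comp (f := fun z : ℝ × B => (z.2, t)) (by fun_prop)) continuous_fst
  · rcases eq_or_ne a 0 with rfl | ha
    · simp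
    · have : (fun z : ℝ × B => levelMax c ψ z.1 z.2) ⁻¹' Iio a =
          {z : ℝ × B | z.1 < cTransform c ψ (z.2, a)} := by
        ext ⟨τ, s⟩
        exact levelMax_lt_iff ψ hc s τ (pos_iff_ne_zero.2 ha)
      rw [this]
      exact isOpen_lt continuous_fst (hcont.comp (f := fun z : ℝ × B => (z.2, a)) (by fun_prop))

lemma continuous_levelMax (τ : ℝ) : Continuous (levelMax c ψ τ) :=
  (continuous_levelMax_uncurry ψ hc).comp (f := fun s => (τ, s)) (by fun_prop)

variable {ψ} in
lemma levelMax_mono {φ : C(Y, ℝ)} {τ τ' : ℝ} (s : B)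
    (h : ∀ t, cTransform c ψ (s, t) ≤ τ → cTransform c φ (s, t) ≤ τ') :
    levelMax c ψ τ s ≤ levelMax c φ τ' s := by
  rcases eq_zero_or_pos (levelMax c ψ τ s) with h0 | h0
  · simp [h0]
  · exact (le_levelMax_iff φ hc s τ' h0).2 (h _ ((le_levelMax_iff ψ hc s τ h0).1 le_rfl))

/-- By continuity the transform stays below `τ'` slightly above the old surface. This strictness
makes the normalising constant unique. -/
lemma levelMax_lt_levelMax {τ τ' : ℝ} (h : τ < τ') (s : B) (hs : levelMax c ψ τ s ≠ 0) :
    levelMax c ψ τ s < levelMax c ψ τ' s := by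
  set t := levelMax c ψ τ s with ht
  have hs' : 0 < t := pos_iff_ne_zero.2 hs
  have h1 : cTransform c ψ (s, t) < τ' := ((le_levelMax_iff ψ hc s τ hs').1 ht.le).trans_lt h
  have hcont : Continuous fun t : ℝ≥0 => cTransform c ψ (s, t) :=
    (continuous_cTransform ψ hc).comp (by fun_prop)
  have hev : ∀ᶠ t' in nhdsWithin t (Ioi t), cTransform c ψ (s, t') < τ' :=
    (hcont.continuousAt.eventually (gt_mem_nhds h1)).filter_mono nhdsWithin_le_nhds
  obtain ⟨t', ht1, ht2⟩ := (hev.and self_mem_nhdsWithin).exists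
  exact (mem_Ioi.1 ht2).trans_le ((le_levelMax_iff ψ hc s τ' (hs'.trans ht2)).2 ht1.le)

end Transform

/-! ### Lebesgue measure on hypographs and the measures `μ_p`. -/

section Measures

variable {m : ℕ} {B : Set (EuclideanSpace ℝ (Fin m))}

lemma measurableEmbedding_nnrealCoe : MeasurableEmbedding ((↑) : ℝ≥0 → ℝ) :=
  MeasurableEmbedding.subtype_coe (measurableSet_Ici (a := (0 : ℝ)))

lemma comap_volume_Iic (a : ℝ≥0) :
    (volume : Measure ℝ).comap ((↑) : ℝ≥0 → ℝ) (Iic a) = a := by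
  rw [measurableEmbedding_nnrealCoe.comap_apply]
  have : ((↑) : ℝ≥0 → ℝ) '' Iic a = Icc 0 (a : ℝ) := by
    ext x
    constructor
    · rintro ⟨t, ht, rfl⟩
      exact ⟨t.2, NNReal.coe_le_coe.2 ht⟩
    · rintro ⟨h0, h1⟩
      exact ⟨⟨x, h0⟩, NNReal.coe_le_coe.1 h1, rfl⟩
  rw [this, Real.volume_Icc, sub_zero, ENNReal.ofReal_coe_nnreal]

lemma comap_volume_eq_zero {s : Set ℝ≥0} (hs : s.Subsingleton) :
    (volume : Measure ℝ).comap ((↑) : ℝ≥0 → ℝ) s = 0 := by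
  rw [measurableEmbedding_nnrealCoe.comap_apply]
  exact (hs.image _).measure_zero _

instance : SFinite ((volume : Measure ℝ).comap ((↑) : ℝ≥0 → ℝ)) := by
  have : SigmaFinite ((volume : Measure ℝ).comap ((↑) : ℝ≥0 → ℝ)) :=
    .of_map _ measurableEmbedding_nnrealCoe.measurable.aemeasurable (by
      rw [measurableEmbedding_nnrealCoe.map_comap]; infer_instance)
  infer_instance

lemma lebB_univ [CompactSpace B] : lebB B univ = volume B := by
  have hB : IsCompact B := isCompact_iff_compactSpace.2 inferInstance
  rw [lebB, (MeasurableEmbedding.subtype_coe hB.measurableSet).comap_apply]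
  simp

instance [CompactSpace B] : IsFiniteMeasure (lebB B) := by
  have hB : IsCompact B := isCompact_iff_compactSpace.2 inferInstance
  exact ⟨by rw [lebB_univ]; exact hB.measure_lt_top⟩

instance [CompactSpace B] : SFinite (lebX B) := by unfold lebX; infer_instance

lemma measurableSet_hypograph {f : B → ℝ≥0} (hf : Measurable f) :
    MeasurableSet {x : B × ℝ≥0 | x.2 ≤ f x.1} :=
  measurableSet_le measurable_snd (hf.comp measurable_fst)

/-- Tonelli: the column above `s` has length `f s`. Hence `p` can be recovered as the first marginal
of `μ_p`. -/
lemma map_fst_restrict_hypograph {f : B → ℝ≥0} (hf : Measurable f) :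
    ((lebX B).restrict {x | x.2 ≤ f x.1}).map Prod.fst =
      (lebB B).withDensity fun s => (f s : ℝ≥0∞) := by
  ext A hA
  rw [Measure.map_apply measurable_fst hA, Measure.restrict_apply (measurable_fst hA),
    withDensity_apply _ hA, lebX, Measure.prod_apply
      ((measurable_fst hA).inter (measurableSet_hypograph hf)), ← lintegral_indicator hA]
  refine lintegral_congr fun s => ?_
  by_cases hs : s ∈ A
  · rw [indicator_of_mem hs, ← comap_volume_Iic]
    congr 1
    ext t
    simp [hs]
  · rw [indicator_of_notMem hs]
    have : Prod.mk s ⁻¹' (Prod.fst ⁻¹' A ∩ {x : B × ℝ≥0 | x.2 ≤ f x.1}) = ∅ := by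
      ext t
      simp [hs]
    rw [this, measure_empty]

lemma lebX_hypograph {f : B → ℝ≥0} (hf : Measurable f) :
    lebX B {x | x.2 ≤ f x.1} = ∫⁻ s, f s ∂(lebB B) := by
  have := congrArg (fun μ => μ univ) (map_fst_restrict_hypograph hf)
  simpa [Measure.map_apply measurable_fst MeasurableSet.univ] using this

lemma lebX_eq_zero_of_subsingleton {S : Set (B × ℝ≥0)} (hS : MeasurableSet S)
    (h : ∀ s, {t | (s, t) ∈ S}.Subsingleton) : lebX B S = 0 := by
  rw [lebX, Measure.measure_prod_null hS]
  exact Filter.Eventually.of_forall fun s => comap_volume_eq_zero (h s)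

/-- Discards the base, the only place where `le_levelMax_iff` does not apply. -/
lemma ae_lebX_snd_ne_zero : ∀ᵐ x ∂(lebX B), x.2 ≠ 0 := by
  have : {x : B × ℝ≥0 | ¬ x.2 ≠ 0} = Prod.snd ⁻¹' {0} := by ext; simp
  rw [ae_iff, this]
  exact lebX_eq_zero_of_subsingleton (measurable_snd (measurableSet_singleton 0))
    fun s t ht t' ht' => Eq.trans ht (Eq.symm ht')

namespace ProbAC

lemma measurable_density (p : ProbAC B) : Measurable p.density :=
  (Measure.measurable_rnDeriv _ _).ennreal_toNNReal

variable [CompactSpace B]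

lemma coe_density_ae (p : ProbAC B) :
    (fun s => (p.density s : ℝ≥0∞)) =ᵐ[lebB B] p.1.rnDeriv (lebB B) := by
  have := p.2.1
  filter_upwards [Measure.rnDeriv_lt_top p.1 (lebB B)] with s hs
  exact ENNReal.coe_toNNReal hs.ne

lemma hasDensity_density (p : ProbAC B) : p.HasDensity p.density := by
  have := p.2.1
  have := Measure.haveLebesgueDecomposition_of_sigmaFinite p.1 (lebB B)
  have h := Measure.withDensity_rnDeriv_eq p.1 (lebB B) p.2.2
  rw [HasDensity, withDensity_congr_ae p.coe_density_ae, h]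

lemma map_fst_sourceMeasure (p : ProbAC B) : (sourceMeasure p).map Prod.fst = p.1 := by
  rw [sourceMeasure, map_fst_restrict_hypograph p.measurable_density, ← p.hasDensity_density]

lemma lebX_hypograph_density (p : ProbAC B) : lebX B {x | x.2 ≤ p.density x.1} = 1 := by
  have := p.2.1
  have h := congrArg (fun μ => μ univ) p.map_fst_sourceMeasure
  simpa [Measure.map_apply measurable_fst MeasurableSet.univ, sourceMeasure] using h

instance (p : ProbAC B) : IsProbabilityMeasure (sourceMeasure p) :=
  ⟨by simpa [sourceMeasure] using p.lebX_hypograph_density⟩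

lemma HasDensity.sourceMeasure_eq {p : ProbAC B} {f : B → ℝ≥0} (hf : Measurable f)
    (h : p.HasDensity f) : sourceMeasure p = (lebX B).restrict {x | x.2 ≤ f x.1} := by
  have hae : p.density =ᵐ[lebB B] f := by
    have h1 := Measure.rnDeriv_withDensity (lebB B) hf.coe_nnreal_ennreal
    rw [← h] at h1
    filter_upwards [h1, p.coe_density_ae] with s h1 h2
    exact ENNReal.coe_injective (h2.trans h1)
  refine Measure.restrict_congr_set ?_
  have := Measure.quasiMeasurePreserving_fst (μ := lebB B)
    (ν := (volume : Measure ℝ).comap ((↑) : ℝ≥0 → ℝ)) |>.ae hae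
  refine Filter.eventuallyEq_set.2 ?_
  filter_upwards [this] with x hx
  simp [hx]

/-- The measure with a given probability density. -/
def ofDensity (f : B → ℝ≥0) (hf : ∫⁻ s, f s ∂(lebB B) = 1) : ProbAC B :=
  ⟨(lebB B).withDensity fun s => (f s : ℝ≥0∞), ⟨by simpa using hf⟩,
    withDensity_absolutelyContinuous _ _⟩

end ProbAC

end Measures

/-! ### Existence, uniqueness and continuity of the normalising constant. -/

section Normalisation

variable {m n : ℕ} {B : Set (EuclideanSpace ℝ (Fin m))} {Y : Set (EuclideanSpace ℝ (Fin n))}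
  {c : B × ℝ≥0 → Y → ℝ≥0} [CompactSpace B] [CompactSpace Y] [Nonempty Y]
  (hc : IsAdmissibleCost c)
include hc

/-- Equal masses of ordered surfaces force equality almost everywhere. Since a surface rises
strictly wherever it is nonzero, it would vanish almost everywhere, contradicting mass one. -/
lemma IsNormalising.eq_of_le {ψ : C(Y, ℝ)} {τ τ' : ℝ} (h : IsNormalising c ψ τ)
    (hττ' : τ ≤ τ') (h' : ∫⁻ s, levelMax c ψ τ' s ∂(lebB B) ≤ 1) : τ = τ' := by
  by_contra hne
  have hlt : τ < τ' := lt_of_le_of_ne hττ' hne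
  have hle (s) : levelMax c ψ τ s ≤ levelMax c ψ τ' s :=
    levelMax_mono hc s fun t ht => ht.trans hττ'
  have hae := ae_eq_of_ae_le_of_lintegral_le (μ := lebB B)
    (f := fun s => (levelMax c ψ τ s : ℝ≥0∞)) (g := fun s => (levelMax c ψ τ' s : ℝ≥0∞))
    (Filter.Eventually.of_forall fun s => ENNReal.coe_le_coe.2 (hle s))
    (by rw [h]; simp) ((continuous_levelMax ψ hc τ').measurable.coe_nnreal_ennreal.aemeasurable)
    (by rwa [h])
  have h0 : ∫⁻ s, levelMax c ψ τ s ∂(lebB B) = 0 := by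
    rw [lintegral_eq_zero_iff ((continuous_levelMax ψ hc τ).measurable.coe_nnreal_ennreal)]
    filter_upwards [hae] with s hs
    by_contra hs0
    have := levelMax_lt_levelMax ψ hc hlt s (by simpa using hs0)
    exact this.ne (ENNReal.coe_injective hs)
  rw [h] at h0
  exact one_ne_zero h0

lemma IsNormalising.unique {ψ : C(Y, ℝ)} {τ τ' : ℝ} (h : IsNormalising c ψ τ)
    (h' : IsNormalising c ψ τ') : τ = τ' := by
  rcases le_total τ τ' with hl | hl
  · exact h.eq_of_le hc hl h'.le
  · exact (h'.eq_of_le hc hl h.le).symm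

lemma exists_isNormalising (hB0 : lebB B univ ≠ 0) (ψ : C(Y, ℝ)) :
    ∃ τ, IsNormalising c ψ τ := by
  let J : ℝ → ℝ := fun τ => ∫ s, (levelMax c ψ τ s : ℝ) ∂(lebB B)
  have hint (τ : ℝ) : Integrable (fun s => (levelMax c ψ τ s : ℝ)) (lebB B) :=
    (NNReal.continuous_coe.comp (continuous_levelMax ψ hc τ)).integrable_of_hasCompactSupport
      (HasCompactSupport.of_compactSpace _)
  have hJ : Continuous J := by
    have := continuous_parametric_integral_of_continuous (μ := lebB B)
      (f := fun τ s => (levelMax c ψ τ s : ℝ))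
      (NNReal.continuous_coe.comp (continuous_levelMax_uncurry ψ hc)) isCompact_univ
    simpa using this
  -- This constant lies below every value of the `c`-transform, so the surface is zero.
  have hlow : J (-‖ψ‖ - 1) ≤ 1 := by
    have : ∀ s, levelMax c ψ (-‖ψ‖ - 1) s = 0 := fun s => by
      by_contra h
      have := (le_levelMax_iff ψ hc s _ (pos_iff_ne_zero.2 h)).1 le_rfl
      linarith [neg_norm_le_cTransform (c := c) ψ (s, levelMax c ψ (-‖ψ‖ - 1) s)]
    simp [J, this]
  have hvol : 0 < (lebB B).real univ := ENNReal.toReal_pos hB0 (measure_ne_top _ _)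
  -- The height at which a flat surface has mass one; for large `τ` the surface lies above it.
  let T : ℝ≥0 := ⟨((lebB B).real univ)⁻¹, by positivity⟩
  have hT : 0 < T := inv_pos.2 hvol
  obtain ⟨τ, hτ⟩ : ∃ τ, 1 ≤ J τ := by
    obtain ⟨R, hR⟩ := hc.exists_bound T
    obtain ⟨y⟩ := ‹Nonempty Y›
    refine ⟨R - ψ y, ?_⟩
    have : ∫ _, (T : ℝ) ∂(lebB B) ≤ J (R - ψ y) := by
      refine integral_mono (integrable_const _) (hint _) fun s => NNReal.coe_le_coe.2 ?_
      rw [le_levelMax_iff ψ hc s _ hT]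
      linarith [cTransform_le (c := c) ψ (s, T) y, hR s y]
    have h2 : ∫ _, (T : ℝ) ∂(lebB B) = 1 := by
      rw [integral_const, smul_eq_mul]
      exact mul_inv_cancel₀ hvol.ne'
    linarith
  obtain ⟨τ, hτ⟩ := mem_range_of_exists_le_of_exists_ge hJ ⟨_, hlow⟩ ⟨τ, hτ⟩
  refine ⟨τ, ?_⟩
  have h1 := ofReal_integral_eq_lintegral_ofReal (hint τ)
    (Filter.Eventually.of_forall fun s => (levelMax c ψ τ s).2)
  change ENNReal.ofReal (J τ) = _ at h1
  rw [hτ] at h1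
  simpa [IsNormalising] using h1.symm

/-- The bound is uniform in `ψ`. If the surface exceeds `T` at one point, the `y` attaining the
transform there shows that `τ` is large enough to put the surface above `T₀` everywhere. Since `T₀`
is `2` over the volume of `B`, the mass would be at least two. -/
lemma exists_levelMax_le (hB0 : lebB B univ ≠ 0) :
    ∃ T : ℝ≥0, ∀ (ψ : C(Y, ℝ)) (τ : ℝ), IsNormalising c ψ τ → ∀ s, levelMax c ψ τ s ≤ T := by
  have hvol : 0 < (lebB B).real univ := ENNReal.toReal_pos hB0 (measure_ne_top _ _)
  let T₀ : ℝ≥0 := ⟨2 * ((lebB B).real univ)⁻¹, by positivity⟩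
  have hT₀ : 0 < T₀ := mul_pos two_pos (inv_pos.2 hvol)
  obtain ⟨R, hR⟩ := hc.exists_bound T₀
  obtain ⟨T, hT⟩ := hc.exists_height R
  refine ⟨T, fun ψ τ h s => ?_⟩
  by_contra! hlt
  have h1 := (le_levelMax_iff ψ hc s τ (pos_of_gt hlt)).1 le_rfl
  obtain ⟨y, hy⟩ := exists_cTransform_eq ψ hc (s, levelMax c ψ τ s)
  have h2 (s') : T₀ ≤ levelMax c ψ τ s' := by
    rw [le_levelMax_iff ψ hc s' _ hT₀]
    linarith [cTransform_le (c := c) ψ (s', T₀) y, hR s' y, hT _ hlt.le s y]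
  have h3 : ∫⁻ _, (T₀ : ℝ≥0∞) ∂(lebB B) ≤ 1 := by
    rw [← (h : _ = _)]
    exact lintegral_mono fun s => ENNReal.coe_le_coe.2 (h2 s)
  have h4 := ENNReal.toReal_mono ENNReal.one_ne_top h3
  rw [lintegral_const, ENNReal.toReal_mul] at h4
  change 2 * ((lebB B).real univ)⁻¹ * (lebB B).real univ ≤ 1 at h4
  rw [mul_assoc, inv_mul_cancel₀ hvol.ne'] at h4
  norm_num at h4

/-- The constant that normalises `ψ`. -/
def normaliser (c : B × ℝ≥0 → Y → ℝ≥0) (ψ : C(Y, ℝ)) : ℝ :=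
  Classical.epsilon (IsNormalising c ψ)

lemma isNormalising_normaliser (hB0 : lebB B univ ≠ 0) (ψ : C(Y, ℝ)) :
    IsNormalising c ψ (normaliser c ψ) :=
  Classical.epsilon_spec (exists_isNormalising hc hB0 ψ)

/-- Sublevel sets of `φᶜ` at `τ` lie in those of `ψᶜ` at `τ + ‖ψ - φ‖`, so the mass there is at
least one. Were this level below the normaliser of `ψ`, it would normalise `ψ` too, against
uniqueness. -/
lemma normaliser_le_add_norm (hB0 : lebB B univ ≠ 0) (ψ φ : C(Y, ℝ)) :
    normaliser c ψ ≤ normaliser c φ + ‖ψ - φ‖ := by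
  by_contra! hlt
  have hψ := isNormalising_normaliser hc hB0 ψ
  have hφ := isNormalising_normaliser hc hB0 φ
  have h1 : IsNormalising c ψ (normaliser c φ + ‖ψ - φ‖) := by
    refine le_antisymm ?_ ?_
    · rw [← (hψ : _ = _)]
      exact lintegral_mono fun s => ENNReal.coe_le_coe.2
        (levelMax_mono hc s fun t ht => ht.trans hlt.le)
    · rw [← (hφ : _ = _)]
      exact lintegral_mono fun s => ENNReal.coe_le_coe.2 (levelMax_mono hc s fun t ht =>
        (cTransform_le_add_norm ψ φ _).trans (by gcongr))
  exact hlt.ne (h1.unique hc hψ)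

lemma continuous_normaliser (hB0 : lebB B univ ≠ 0) :
    Continuous (normaliser c : C(Y, ℝ) → ℝ) :=
  (LipschitzWith.of_le_add fun ψ φ => by
    rw [dist_eq_norm]; exact normaliser_le_add_norm hc hB0 ψ φ).continuous

end Normalisation

/-! ### Weak and strong duality for the transport cost. -/

section Transport

variable {m n : ℕ} {B : Set (EuclideanSpace ℝ (Fin m))} {Y : Set (EuclideanSpace ℝ (Fin n))}
  {c : B × ℝ≥0 → Y → ℝ≥0} [CompactSpace B] [CompactSpace Y]

lemma integrable_of_ae_snd_le {μ : Measure (B × ℝ≥0)} [IsFiniteMeasure μ] {T : ℝ≥0}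
    (hμ : ∀ᵐ x ∂μ, x.2 ≤ T) {g : B × ℝ≥0 → ℝ} (hg : Continuous g) : Integrable g μ := by
  have hK : IsCompact ((univ : Set B) ×ˢ Icc 0 T) := isCompact_univ.prod isCompact_Icc
  obtain ⟨C, hC⟩ := hK.exists_bound_of_continuousOn hg.continuousOn
  refine Integrable.of_bound hg.aestronglyMeasurable C ?_
  filter_upwards [hμ] with x hx
  exact hC x ⟨mem_univ _, zero_le, hx⟩

lemma integrable_potential (ν : Measure Y) [IsFiniteMeasure ν] (ψ : C(Y, ℝ)) : Integrable ψ ν :=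
  integrable_continuousMap ν ψ

/-- The Kantorovich functional as a real number. -/
def kantorovichReal (c : B × ℝ≥0 → Y → ℝ≥0) (μ : Measure (B × ℝ≥0)) (ν : Measure Y)
    (ψ : C(Y, ℝ)) : ℝ :=
  ∫ x, cTransform c ψ x ∂μ + ∫ y, ψ y ∂ν

omit [CompactSpace B] [CompactSpace Y] in
lemma kantorovich_eq_coe {μ : Measure (B × ℝ≥0)} (ν : Measure Y) {ψ : C(Y, ℝ)}
    (h : Integrable (cTransform c ψ) μ) :
    kantorovich c μ ν ψ = (kantorovichReal c μ ν ψ : ℝ) := by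
  have h1 : ∫⁻ x, ENNReal.ofReal (cTransform c ψ x) ∂μ ≠ ⊤ := h.lintegral_lt_top.ne
  have h2 : ∫⁻ x, ENNReal.ofReal (-cTransform c ψ x) ∂μ ≠ ⊤ := h.neg.lintegral_lt_top.ne
  rw [kantorovich, kantorovichReal, extIntegral,
    integral_eq_lintegral_pos_part_sub_lintegral_neg_part h, EReal.coe_add, EReal.coe_sub,
    EReal.coe_ennreal_toReal h1, EReal.coe_ennreal_toReal h2]

variable [Nonempty Y] (hc : IsAdmissibleCost c)
include hc

-- The transform is bounded below and `μ` is finite, so only its positive part can fail to be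
-- integrable.
omit [CompactSpace B] in
lemma kantorovich_eq_top {μ : Measure (B × ℝ≥0)} [IsFiniteMeasure μ] (ν : Measure Y)
    {ψ : C(Y, ℝ)} (h : ¬ Integrable (cTransform c ψ) μ) : kantorovich c μ ν ψ = ⊤ := by
  have hm := (continuous_cTransform ψ hc).measurable
  have h2 : ∫⁻ x, ENNReal.ofReal (-cTransform c ψ x) ∂μ ≠ ⊤ := by
    refine ne_top_of_le_ne_top ?_ (lintegral_mono fun x => ENNReal.ofReal_le_ofReal
      (neg_le.1 (neg_norm_le_cTransform (c := c) ψ x)))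
    simp [lintegral_const, ENNReal.mul_eq_top]
  have h1 : ∫⁻ x, ENNReal.ofReal (cTransform c ψ x) ∂μ = ⊤ := by
    by_contra h1
    refine h ⟨hm.aestronglyMeasurable, ?_⟩
    rw [hasFiniteIntegral_iff_norm]
    have : ∀ x, ENNReal.ofReal ‖cTransform c ψ x‖ ≤
        ENNReal.ofReal (cTransform c ψ x) + ENNReal.ofReal (-cTransform c ψ x) := fun x => by
      rcases le_total 0 (cTransform c ψ x) with h0 | h0
      · rw [Real.norm_of_nonneg h0]; exact le_self_add
      · rw [Real.norm_of_nonpos h0]; exact le_add_self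
    refine (lintegral_mono this).trans_lt ?_
    rw [lintegral_add_left hm.ennreal_ofReal]
    exact ENNReal.add_lt_top.2 ⟨lt_top_iff_ne_top.2 h1, lt_top_iff_ne_top.2 h2⟩
  rw [kantorovich, extIntegral, h1]
  lift ∫⁻ x, ENNReal.ofReal (-cTransform c ψ x) ∂μ to ℝ≥0 using h2 with a
  rw [EReal.coe_ennreal_top]
  change ⊤ - ((a : ℝ) : EReal) + _ = ⊤
  rw [EReal.top_sub_coe, EReal.top_add_coe]

omit [CompactSpace B] in
lemma kantorovich_le_of_plan {μ : Measure (B × ℝ≥0)} [IsProbabilityMeasure μ] {ν : Measure Y}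
    [IsProbabilityMeasure ν] (ψ : C(Y, ℝ)) {γ : Measure ((B × ℝ≥0) × Y)}
    (hγ : γ ∈ transportPlans μ ν) :
    kantorovich c μ ν ψ ≤ ((∫⁻ z, (c z.1 z.2 : ℝ≥0∞) ∂γ : ℝ≥0∞) : EReal) := by
  obtain ⟨hprob, h1, h2⟩ := hγ
  by_cases htop : ∫⁻ z, (c z.1 z.2 : ℝ≥0∞) ∂γ = ⊤
  · simp [htop]
  have hci : Integrable (fun z : (B × ℝ≥0) × Y => (c z.1 z.2 : ℝ)) γ := by
    refine ⟨hc.continuous.aestronglyMeasurable, ?_⟩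
    rw [hasFiniteIntegral_iff_ofReal (Filter.Eventually.of_forall fun z => NNReal.coe_nonneg _)]
    simpa [lt_top_iff_ne_top] using htop
  have hψi : Integrable (fun z : (B × ℝ≥0) × Y => ψ z.2) γ := by
    have := integrable_potential ν ψ
    rw [← h2] at this
    exact this.comp_measurable measurable_snd
  have hcont := continuous_cTransform ψ hc
  have hΦi : Integrable (fun z : (B × ℝ≥0) × Y => cTransform c ψ z.1) γ := by
    -- The transform lies between `-‖ψ‖` and `c + ‖ψ‖`, so finite cost makes it integrable.
    refine (hci.add (integrable_const (‖ψ‖ + ‖ψ‖))).mono'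
      (hcont.comp continuous_fst).aestronglyMeasurable (Filter.Eventually.of_forall fun z => ?_)
    have h3 := neg_norm_le_cTransform (c := c) ψ z.1
    have h4 := cTransform_le (c := c) ψ z.1 z.2
    have h5 := (abs_le.1 (ψ.norm_coe_le_norm z.2)).1
    have h6 := (c z.1 z.2).coe_nonneg
    have h7 := norm_nonneg ψ
    rw [Real.norm_eq_abs, abs_le, Pi.add_apply]
    constructor <;> linarith
  have hΦμ : Integrable (cTransform c ψ) μ := by
    rw [← h1]
    exact (integrable_map_measure hcont.aestronglyMeasurable measurable_fst.aemeasurable).2 hΦi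
  have e1 : ∫ x, cTransform c ψ x ∂μ = ∫ z, cTransform c ψ z.1 ∂γ := by
    rw [← h1, integral_map measurable_fst.aemeasurable hcont.aestronglyMeasurable]
  have e2 : ∫ y, ψ y ∂ν = ∫ z, ψ z.2 ∂γ := by
    rw [← h2, integral_map measurable_snd.aemeasurable
      (map_continuous ψ).aestronglyMeasurable]
  have e3 : ∫⁻ z, (c z.1 z.2 : ℝ≥0∞) ∂γ = ENNReal.ofReal (∫ z, (c z.1 z.2 : ℝ) ∂γ) := by
    rw [ofReal_integral_eq_lintegral_ofReal hci
      (Filter.Eventually.of_forall fun z => (c z.1 z.2).2)]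
    simp
  rw [kantorovich_eq_coe ν hΦμ, kantorovichReal, e1, e2, e3, ← integral_add hΦi hψi,
    EReal.coe_ennreal_ofReal]
  refine EReal.coe_le_coe_iff.2 (le_max_of_le_left ?_)
  exact integral_mono (hΦi.add hψi) hci fun z => by
    have := cTransform_le (c := c) ψ z.1 z.2
    change cTransform c ψ z.1 + ψ z.2 ≤ c z.1 z.2
    linarith

omit [CompactSpace B] in
/-- Weak duality. -/
lemma kantorovich_le_transportCost (μ : Measure (B × ℝ≥0)) [IsProbabilityMeasure μ]
    (ν : Measure Y) [IsProbabilityMeasure ν] (ψ : C(Y, ℝ)) :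
    kantorovich c μ ν ψ ≤ (transportCost c μ ν : EReal) := by
  -- The cost is an infimum in `ℝ≥0∞` while the functional may be negative, so it is first replaced
  -- by its positive part.
  refine ((le_max_right _ _).trans_eq EReal.coe_toENNReal_eq_max.symm).trans (EReal.coe_ennreal_le_coe_ennreal_iff.2 ?_)
  refine le_iInf₂ fun γ hγ => ?_
  have := EReal.toENNReal_le_toENNReal (kantorovich_le_of_plan hc ψ hγ)
  rwa [EReal.toENNReal_coe] at this

/-- Strong duality for a source measure of bounded height that has a Kantorovich potential. -/
lemma transportCost_le_kantorovich {μ : Measure (B × ℝ≥0)} [IsProbabilityMeasure μ]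
    {T : ℝ≥0} (hμ : ∀ᵐ x ∂μ, x.2 ≤ T) (ν : Measure Y) [IsProbabilityMeasure ν] {ψ : C(Y, ℝ)}
    (hψ : IsKantorovichPotential c μ ν ψ) :
    (transportCost c μ ν : EReal) ≤ kantorovich c μ ν ψ := by
  have hint (φ : C(Y, ℝ)) := integrable_of_ae_snd_le hμ (continuous_cTransform φ hc)
  -- The slab of height `T` is compact and carries `μ`; `r` truncates onto it and `ι` embeds it
  -- back.
  let ι : B × Icc (0 : ℝ≥0) T → B × ℝ≥0 := fun x => (x.1, x.2)
  let r : B × ℝ≥0 → B × Icc (0 : ℝ≥0) T :=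
    fun x => (x.1, ⟨min x.2 T, zero_le, min_le_right _ _⟩)
  have hι : Continuous ι := by fun_prop
  have hr : Continuous r := by fun_prop
  have hιr : ∀ᵐ x ∂μ, ι (r x) = x := by
    filter_upwards [hμ] with x hx
    simp [ι, r, hx]
  have : IsProbabilityMeasure (μ.map r) := Measure.isProbabilityMeasure_map hr.aemeasurable
  let c' : C((B × Icc (0 : ℝ≥0) T) × Y, ℝ) :=
    ⟨fun z => (c (ι z.1) z.2 : ℝ), hc.continuous.comp
      (f := fun z : (B × Icc (0 : ℝ≥0) T) × Y => (ι z.1, z.2)) (by fun_prop)⟩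
  obtain ⟨γ, ⟨hγ, h1, h2⟩, hcost⟩ :=
    exists_plan_of_dual_le c' (μ.map r) ν (kantorovichReal c μ ν ψ) (fun f g hfg => by
      have h3 := hψ g
      rw [kantorovich_eq_coe ν (hint g), kantorovich_eq_coe ν (hint ψ),
        EReal.coe_le_coe_iff] at h3
      -- An admissible pair satisfies `f ≤ gᶜ` on the slab, so its dual value is at most that of
      -- `g`, hence at most that of the potential `ψ`.
      refine le_trans (add_le_add_left ?_ _) h3
      rw [integral_map hr.aemeasurable (map_continuous f).aestronglyMeasurable]
      refine integral_mono_ae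
        (integrable_of_ae_snd_le hμ ((map_continuous f).comp hr)) (hint g) ?_
      filter_upwards [hιr] with x hx
      refine le_cTransform fun y => ?_
      have h4 : f (r x) + g y ≤ c (ι (r x)) y := hfg (r x) y
      rw [hx] at h4
      linarith)
  have hpush : Measurable (Prod.map ι id : _ → (B × ℝ≥0) × Y) :=
    hι.measurable.prodMap measurable_id
  have hmem : γ.map (Prod.map ι id) ∈ transportPlans μ ν := by
    refine ⟨Measure.isProbabilityMeasure_map hpush.aemeasurable, ?_, ?_⟩
    · rw [Measure.map_map measurable_fst hpush]
      change γ.map (ι ∘ Prod.fst) = μ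
      rw [← Measure.map_map hι.measurable measurable_fst, h1,
        Measure.map_map hι.measurable hr.measurable, Measure.map_congr (f := ι ∘ r) (g := id) hιr,
        Measure.map_id]
    · rw [Measure.map_map measurable_snd hpush]
      exact h2
  have hm : Measurable fun z : (B × ℝ≥0) × Y => (c z.1 z.2 : ℝ≥0∞) :=
    hc.locallyLipschitz.continuous.measurable.coe_nnreal_ennreal
  have h5 : ∫⁻ z, (c z.1 z.2 : ℝ≥0∞) ∂(γ.map (Prod.map ι id)) =
      ENNReal.ofReal (∫ z, c' z ∂γ) := by
    rw [ofReal_integral_eq_lintegral_ofReal (integrable_continuousMap γ c')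
      (Filter.Eventually.of_forall fun z => NNReal.coe_nonneg _), lintegral_map hm hpush]
    simp [c']
  have h6 : 0 ≤ ∫ z, c' z ∂γ := integral_nonneg fun z => NNReal.coe_nonneg _
  have h7 : transportCost c μ ν ≤ ENNReal.ofReal (∫ z, c' z ∂γ) := by
    rw [← h5]
    exact iInf₂_le _ hmem
  refine (EReal.coe_ennreal_le_coe_ennreal_iff.2 h7).trans ?_
  rw [EReal.coe_ennreal_ofReal, max_eq_left h6, kantorovich_eq_coe ν (hint ψ)]
  exact EReal.coe_le_coe_iff.2 hcost

end Transport

/-! ### Optimal surfaces, the dual maximiser and the absence of a duality gap. -/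

section Optimisation

variable {m n : ℕ} {B : Set (EuclideanSpace ℝ (Fin m))} {Y : Set (EuclideanSpace ℝ (Fin n))}
  {c : B × ℝ≥0 → Y → ℝ≥0} [CompactSpace B] [CompactSpace Y] [Nonempty Y]

/-- The region `{(s, t) : t ≤ p_ψ(s)}` below the optimal surface. -/
def region (c : B × ℝ≥0 → Y → ℝ≥0) (ψ : C(Y, ℝ)) : Set (B × ℝ≥0) :=
  {x | x.2 ≤ optimalSurface c ψ x.1}

lemma continuous_optimalSurface (hc : IsAdmissibleCost c) (ψ : C(Y, ℝ)) :
    Continuous (optimalSurface c ψ) :=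
  continuous_levelMax ψ hc (normaliser c ψ)

lemma measurableSet_region (hc : IsAdmissibleCost c) (ψ : C(Y, ℝ)) :
    MeasurableSet (region c ψ) :=
  measurableSet_hypograph (continuous_optimalSurface hc ψ).measurable

lemma ae_mem_region_iff (hc : IsAdmissibleCost c) (ψ : C(Y, ℝ)) :
    ∀ᵐ x ∂(lebX B), x ∈ region c ψ ↔ cTransform c ψ x ≤ normaliser c ψ := by
  filter_upwards [ae_lebX_snd_ne_zero] with x hx
  exact le_levelMax_iff ψ hc x.1 (normaliser c ψ) (pos_iff_ne_zero.2 hx)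

-- Each vertical line meets a level set at most once, by strict monotonicity. This gives both the
-- equality case of the bathtub principle and the continuity of surfaces in the potential.
omit [CompactSpace B] in
lemma ae_cTransform_ne (hc : IsAdmissibleCost c) (ψ : C(Y, ℝ)) (τ : ℝ) :
    ∀ᵐ x ∂(lebX B), cTransform c ψ x ≠ τ := by
  have : {x : B × ℝ≥0 | ¬ cTransform c ψ x ≠ τ} = cTransform c ψ ⁻¹' {τ} := by ext; simp
  rw [ae_iff, this]
  exact lebX_eq_zero_of_subsingleton
    ((continuous_cTransform ψ hc).measurable (measurableSet_singleton τ))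
    fun s t ht t' ht' => (cTransform_strictMono ψ hc s).injective (Eq.trans ht (Eq.symm ht'))

variable (hc : IsAdmissibleCost c) (hB0 : lebB B univ ≠ 0)

/-- The probability measure on `B` whose density is the optimal surface of `ψ`. -/
def optimalProb (ψ : C(Y, ℝ)) : ProbAC B :=
  ProbAC.ofDensity (optimalSurface c ψ) (isNormalising_normaliser hc hB0 ψ)

lemma hasDensity_optimalProb (ψ : C(Y, ℝ)) :
    (optimalProb hc hB0 ψ).HasDensity (optimalSurface c ψ) := rfl

lemma sourceMeasure_optimalProb (ψ : C(Y, ℝ)) :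
    sourceMeasure (optimalProb hc hB0 ψ) = (lebX B).restrict (region c ψ) :=
  (hasDensity_optimalProb hc hB0 ψ).sourceMeasure_eq (continuous_optimalSurface hc ψ).measurable

include hc hB0 in
lemma exists_forall_region_le :
    ∃ T : ℝ≥0, ∀ (ψ : C(Y, ℝ)), ∀ x ∈ region c ψ, x.2 ≤ T := by
  obtain ⟨T, hT⟩ := exists_levelMax_le hc hB0
  exact ⟨T, fun ψ x hx => le_trans hx (hT ψ _ (isNormalising_normaliser hc hB0 ψ) x.1)⟩

lemma exists_ae_le_optimalProb : ∃ T : ℝ≥0, ∀ (ψ : C(Y, ℝ)),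
    ∀ᵐ x ∂(sourceMeasure (optimalProb hc hB0 ψ)), x.2 ≤ T := by
  obtain ⟨T, hT⟩ := exists_forall_region_le hc hB0
  refine ⟨T, fun ψ => ?_⟩
  rw [sourceMeasure_optimalProb]
  filter_upwards [ae_restrict_mem (measurableSet_region hc ψ)] with x hx using hT ψ x hx

lemma integrable_optimalProb (ψ : C(Y, ℝ)) {g : B × ℝ≥0 → ℝ} (hg : Continuous g) :
    Integrable g (sourceMeasure (optimalProb hc hB0 ψ)) := by
  obtain ⟨T, hT⟩ := exists_ae_le_optimalProb hc hB0
  exact integrable_of_ae_snd_le (hT ψ) hg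

include hc hB0 in
lemma lebX_region (ψ : C(Y, ℝ)) : lebX B (region c ψ) = 1 :=
  (lebX_hypograph (continuous_optimalSurface hc ψ).measurable).trans
    (isNormalising_normaliser hc hB0 ψ)

lemma integral_cTransform_optimalProb_le (ψ : C(Y, ℝ)) (p : ProbAC B)
    (hp : Integrable (cTransform c ψ) (sourceMeasure p)) :
    ∫ x, cTransform c ψ x ∂(sourceMeasure (optimalProb hc hB0 ψ)) ≤
      ∫ x, cTransform c ψ x ∂(sourceMeasure p) := by
  have h := integrable_optimalProb hc hB0 ψ (continuous_cTransform ψ hc)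
  rw [sourceMeasure_optimalProb] at h ⊢
  exact bathtub_le (measurableSet_hypograph p.measurable_density) (measurableSet_region hc ψ)
    p.lebX_hypograph_density (lebX_region hc hB0 ψ) hp h (ae_mem_region_iff hc ψ)

lemma eq_optimalProb_of_integral_le (ψ : C(Y, ℝ)) (p : ProbAC B)
    (hp : Integrable (cTransform c ψ) (sourceMeasure p))
    (hle : ∫ x, cTransform c ψ x ∂(sourceMeasure p) ≤
      ∫ x, cTransform c ψ x ∂(sourceMeasure (optimalProb hc hB0 ψ))) :
    p = optimalProb hc hB0 ψ := by
  have h := integrable_optimalProb hc hB0 ψ (continuous_cTransform ψ hc)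
  rw [sourceMeasure_optimalProb] at h hle
  have hae := bathtub_eq (measurableSet_hypograph p.measurable_density)
    (measurableSet_region hc ψ) p.lebX_hypograph_density (lebX_region hc hB0 ψ) hp h
    (ae_mem_region_iff hc ψ) (ae_cTransform_ne hc ψ _) hle
  have hs : sourceMeasure p = sourceMeasure (optimalProb hc hB0 ψ) := by
    rw [sourceMeasure_optimalProb]
    exact Measure.restrict_congr_set hae
  refine Subtype.ext ?_
  rw [← p.map_fst_sourceMeasure, hs, ProbAC.map_fst_sourceMeasure]

/-- The dual functional as a real number. -/
def dualReal (ν : Measure Y) (ψ : C(Y, ℝ)) : ℝ :=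
  kantorovichReal c (sourceMeasure (optimalProb hc hB0 ψ)) ν ψ

lemma dualReal_le (ν : Measure Y) (ψ : C(Y, ℝ)) (p : ProbAC B)
    (hp : Integrable (cTransform c ψ) (sourceMeasure p)) :
    dualReal hc hB0 ν ψ ≤ kantorovichReal c (sourceMeasure p) ν ψ :=
  add_le_add_left (integral_cTransform_optimalProb_le hc hB0 ψ p hp) _

lemma kantorovich_optimalProb (ν : Measure Y) (ψ φ : C(Y, ℝ)) :
    kantorovich c (sourceMeasure (optimalProb hc hB0 ψ)) ν φ =
      (kantorovichReal c (sourceMeasure (optimalProb hc hB0 ψ)) ν φ : ℝ) :=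
  kantorovich_eq_coe ν (integrable_optimalProb hc hB0 ψ (continuous_cTransform φ hc))

lemma dual_eq_coe (ν : Measure Y) (ψ : C(Y, ℝ)) :
    dual c ν ψ = (dualReal hc hB0 ν ψ : ℝ) := by
  refine le_antisymm ?_ (le_iInf fun p => ?_)
  · rw [dualReal, ← kantorovich_optimalProb]
    exact iInf_le _ _
  · by_cases hp : Integrable (cTransform c ψ) (sourceMeasure p)
    · rw [kantorovich_eq_coe ν hp]
      exact EReal.coe_le_coe_iff.2 (dualReal_le hc hB0 ν ψ p hp)
    · rw [kantorovich_eq_top hc ν hp]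
      exact le_top

lemma eq_optimalProb_of_kantorovich_le (ν : Measure Y) (ψ : C(Y, ℝ)) (p : ProbAC B)
    (h : kantorovich c (sourceMeasure p) ν ψ ≤ dual c ν ψ) : p = optimalProb hc hB0 ψ := by
  rw [dual_eq_coe hc hB0] at h
  by_cases hp : Integrable (cTransform c ψ) (sourceMeasure p)
  · rw [kantorovich_eq_coe ν hp, EReal.coe_le_coe_iff] at h
    exact eq_optimalProb_of_integral_le hc hB0 ψ p hp (le_of_add_le_add_right h)
  · rw [kantorovich_eq_top hc ν hp, top_le_iff] at h
    exact absurd h (EReal.coe_ne_top _)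

omit [CompactSpace B] in
lemma kantorovichReal_le_add_norm {μ : Measure (B × ℝ≥0)} [IsProbabilityMeasure μ] (ν : Measure Y)
    [IsProbabilityMeasure ν] {ψ φ : C(Y, ℝ)} (hψ : Integrable (cTransform c ψ) μ)
    (hφ : Integrable (cTransform c φ) μ) :
    kantorovichReal c μ ν ψ ≤ kantorovichReal c μ ν φ + 2 * ‖ψ - φ‖ := by
  have h1 := integral_mono hψ (hφ.add (integrable_const ‖ψ - φ‖))
    fun x => cTransform_le_add_norm ψ φ x
  have h2 : ∫ y, ψ y ∂ν ≤ ∫ y, (φ y + ‖ψ - φ‖) ∂ν :=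
    integral_mono (integrable_potential ν ψ)
      ((integrable_potential ν φ).add (integrable_const _)) fun y => by
        have := (abs_le.1 ((ψ - φ).norm_coe_le_norm y)).2
        rw [ContinuousMap.sub_apply] at this
        change ψ y ≤ φ y + ‖ψ - φ‖
        linarith
  rw [integral_add' hφ (integrable_const _)] at h1
  rw [integral_add (integrable_potential ν φ) (integrable_const _)] at h2
  simp only [integral_const, probReal_univ, one_smul] at h1 h2
  unfold kantorovichReal
  linarith

/-- The surface of `φ` is a competitor in the infimum for `ψ`, and with the surface fixed `K` is
2-Lipschitz in the potential. -/
lemma continuous_dualReal (ν : Measure Y) [IsProbabilityMeasure ν] :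
    Continuous (dualReal hc hB0 ν) := by
  refine (LipschitzWith.of_le_add_mul 2 fun ψ φ => ?_).continuous
  have hint (θ : C(Y, ℝ)) :=
    integrable_optimalProb hc hB0 φ (continuous_cTransform θ hc)
  rw [dist_eq_norm]
  exact (dualReal_le hc hB0 ν ψ _ (hint ψ)).trans
    (kantorovichReal_le_add_norm ν (hint ψ) (hint φ))

include hc in
/-- On sources of height at most `T`, every potential can be replaced by one that is at least as
good and that has a modulus of continuity given by `c`. -/
lemma exists_better_potential (T : ℝ≥0) (y₀ : Y) (A : C(Y, C(B × Icc (0 : ℝ≥0) T, ℝ)))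
    (hA : ∀ y x, A y x = c (x.1, x.2) y) (ψ : C(Y, ℝ)) :
    ∃ φ : C(Y, ℝ), φ y₀ = 0 ∧ (∀ y y', dist (φ y) (φ y') ≤ dist (A y) (A y')) ∧
      ∃ a : ℝ, (∀ y, ψ y - a ≤ φ y) ∧
        ∀ x : B × ℝ≥0, x.2 ≤ T → cTransform c ψ x + a ≤ cTransform c φ x := by
  rcases isEmpty_or_nonempty B with hB | hB
  · refine ⟨0, rfl, by simp, ‖ψ‖, fun y => ?_, fun x => (IsEmpty.false x.1).elim⟩
    have := (abs_le.1 (ψ.norm_coe_le_norm y)).2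
    simpa using this
  have hN : Nonempty (B × Icc (0 : ℝ≥0) T) :=
    ⟨(Classical.arbitrary B, ⟨0, le_rfl, zero_le⟩)⟩
  let Φ : C(B × Icc (0 : ℝ≥0) T, ℝ) :=
    ⟨fun x => cTransform c ψ (x.1, x.2), (continuous_cTransform ψ hc).comp (by fun_prop)⟩
  -- A second `c`-transform, taken over the slab only. It dominates `ψ`, its own transform dominates
  -- `ψᶜ` on the slab, and it inherits the modulus of `A`. Subtracting `f y₀` normalises it.
  let f : Y → ℝ := fun y => ⨅ x, (A y - Φ) x
  have hbdd (y) : BddBelow (range (A y - Φ)) :=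
    (isCompact_range (map_continuous (A y - Φ))).bddBelow
  have hle (y y') : f y ≤ f y' + dist (A y) (A y') := by
    rw [← sub_le_iff_le_add]
    refine le_ciInf fun x => ?_
    have h1 : f y ≤ (A y - Φ) x := ciInf_le (hbdd y) x
    have h2 := (abs_le.1 (ContinuousMap.dist_apply_le_dist (f := A y) (g := A y') x)).2
    simp only [ContinuousMap.sub_apply] at h1 ⊢
    linarith
  have hdist (y y') : dist (f y) (f y') ≤ dist (A y) (A y') := by
    rw [Real.dist_eq, abs_le]
    have h1 := hle y y'
    have h2 := hle y' y
    rw [dist_comm] at h2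
    constructor <;> linarith
  have hf : Continuous f := by
    refine continuous_iff_continuousAt.2 fun y => ?_
    rw [ContinuousAt, tendsto_iff_dist_tendsto_zero]
    have h0 := tendsto_iff_dist_tendsto_zero.1 ((map_continuous A).tendsto y)
    exact squeeze_zero (fun _ => dist_nonneg) (fun y' => hdist y' y) h0
  refine ⟨⟨fun y => f y - f y₀, by fun_prop⟩, sub_self _, fun y y' => ?_, f y₀, fun y => ?_,
    fun x hx => ?_⟩
  · simpa using hdist y y'
  · refine sub_le_sub_right (le_ciInf fun x => ?_) _
    have h1 := cTransform_le (c := c) ψ (x.1, x.2) y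
    have h2 := hA y x
    change ψ y ≤ A y x - cTransform c ψ (x.1, x.2)
    linarith
  · refine le_cTransform fun y => ?_
    have h1 : f y ≤ A y (x.1, ⟨x.2, zero_le, hx⟩) - cTransform c ψ x :=
      ciInf_le (hbdd y) (x.1, ⟨x.2, zero_le, hx⟩)
    rw [hA] at h1
    change cTransform c ψ x + f y₀ ≤ c x y - (f y - f y₀)
    change f y ≤ (c x y : ℝ) - cTransform c ψ x at h1
    linarith

/-- Restriction to the equicontinuous, pointwise bounded family `F` loses nothing, and `F` is
compact by Arzelà–Ascoli. -/
lemma exists_dualReal_max (ν : Measure Y) [IsProbabilityMeasure ν] :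
    ∃ ψ, ∀ φ, dualReal hc hB0 ν φ ≤ dualReal hc hB0 ν ψ := by
  obtain ⟨T, hT⟩ := exists_ae_le_optimalProb hc hB0
  obtain ⟨y₀⟩ := ‹Nonempty Y›
  let c' : C(Y × (B × Icc (0 : ℝ≥0) T), ℝ) :=
    ⟨fun z => (c (z.2.1, z.2.2) z.1 : ℝ), hc.continuous.comp
      (f := fun z : Y × (B × Icc (0 : ℝ≥0) T) => ((z.2.1, (z.2.2 : ℝ≥0)), z.1)) (by fun_prop)⟩
  let A := c'.curry
  have hA : ∀ y x, A y x = c (x.1, x.2) y := fun y x => rfl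
  let F : Set (BoundedContinuousFunction Y ℝ) :=
    {φ | φ y₀ = 0 ∧ ∀ y y', dist (φ y) (φ y') ≤ dist (A y) (A y')}
  have hbetter (ψ : C(Y, ℝ)) :
      ∃ φ ∈ F, dualReal hc hB0 ν ψ ≤ dualReal hc hB0 ν φ.toContinuousMap := by
    have : Nonempty Y := ⟨y₀⟩
    obtain ⟨φ, h0, hmod, a, ha, hΦ⟩ := exists_better_potential hc T y₀ A hA ψ
    refine ⟨BoundedContinuousFunction.mkOfCompact φ, ⟨h0, hmod⟩, ?_⟩
    change _ ≤ dualReal hc hB0 ν φ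
    have hint (θ : C(Y, ℝ)) :=
      integrable_optimalProb hc hB0 φ (continuous_cTransform θ hc)
    -- Both potentials are compared on the surface of `φ`, where the height bound holds. The shifts
    -- by `a` cancel since `μ` and `ν` have equal mass.
    refine (dualReal_le hc hB0 ν ψ _ (hint ψ)).trans ?_
    have h1 := integral_mono_ae ((hint ψ).add (integrable_const a)) (hint φ)
      ((hT φ).mono fun x hx => hΦ x hx)
    have h2 := integral_mono ((integrable_potential ν ψ).sub (integrable_const a))
      (integrable_potential ν φ) ha
    rw [integral_add' (hint ψ) (integrable_const a)] at h1
    rw [integral_sub' (integrable_potential ν ψ) (integrable_const a)] at h2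
    simp only [integral_const, probReal_univ, one_smul] at h1 h2
    unfold dualReal kantorovichReal
    linarith
  have hdA (y : Y) : Continuous fun y' => dist (A y) (A y') :=
    continuous_const.dist (map_continuous A)
  have hclosed : IsClosed F := by
    have : F = {φ | φ y₀ = 0} ∩ ⋂ y, ⋂ y', {φ | dist (φ y) (φ y') ≤ dist (A y) (A y')} := by
      ext; simp [F]
    have hev (y : Y) : Continuous fun φ : BoundedContinuousFunction Y ℝ => φ y :=
      continuous_eval_const y
    rw [this]
    exact (isClosed_eq (hev y₀) continuous_const).inter (isClosed_iInter fun y =>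
      isClosed_iInter fun y' => isClosed_le ((hev y).dist (hev y')) continuous_const)
  obtain ⟨R, hR⟩ := (isCompact_range (hdA y₀)).bddAbove
  have hcpt : IsCompact F := by
    refine BoundedContinuousFunction.arzela_ascoli₂ (Metric.closedBall (0 : ℝ) R)
      (isCompact_closedBall 0 R) F hclosed (fun φ y hφ => ?_) ?_
    · rw [Metric.mem_closedBall, dist_comm, ← hφ.1]
      exact (hφ.2 y₀ y).trans (hR ⟨y, rfl⟩)
    · intro y
      refine Metric.equicontinuousAt_of_continuity_modulus (fun y' => dist (A y) (A y')) ?_ _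
        (Filter.Eventually.of_forall fun y' φ => φ.2.2 y y')
      simpa using (hdA y).tendsto y
  have hcont : Continuous fun φ : BoundedContinuousFunction Y ℝ =>
      dualReal hc hB0 ν φ.toContinuousMap :=
    (continuous_dualReal hc hB0 ν).comp
      (ContinuousMap.isometryEquivBoundedOfCompact Y ℝ).symm.isometry.continuous
  obtain ⟨φ₁, hφ₁, -⟩ := hbetter 0
  obtain ⟨φ, -, hmax⟩ := hcpt.exists_isMaxOn ⟨φ₁, hφ₁⟩ hcont.continuousOn
  refine ⟨φ.toContinuousMap, fun ψ => ?_⟩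
  obtain ⟨θ, hθ, hle⟩ := hbetter ψ
  exact hle.trans (hmax hθ)

/-- Dominated convergence on a common slab: off the null set `ψᶜ = τ_ψ`, membership in the region is
locally constant in the potential, as `ψᶜ(x)` and `τ_ψ` both depend continuously on `ψ`. -/
lemma continuous_integral_optimalProb {g : B × ℝ≥0 → ℝ} (hg : Continuous g) :
    Continuous fun ψ : C(Y, ℝ) => ∫ x, g x ∂(sourceMeasure (optimalProb hc hB0 ψ)) := by
  obtain ⟨T, hT⟩ := exists_forall_region_le hc hB0
  simp_rw [sourceMeasure_optimalProb, ← integral_indicator (measurableSet_region hc _)]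
  have hTm : MeasurableSet {x : B × ℝ≥0 | x.2 ≤ T} := measurableSet_hypograph measurable_const
  have hTfin : lebX B {x | x.2 ≤ T} ≠ ⊤ := by
    rw [lebX_hypograph (f := fun _ => T) measurable_const, lintegral_const]
    exact ENNReal.mul_ne_top ENNReal.coe_ne_top (measure_ne_top _ _)
  have : IsFiniteMeasure ((lebX B).restrict {x | x.2 ≤ T}) :=
    ⟨by simpa using hTfin.lt_top⟩
  have hbound : Integrable ({x : B × ℝ≥0 | x.2 ≤ T}.indicator fun x => ‖g x‖) (lebX B) :=
    (integrable_indicator_iff hTm).2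
      (integrable_of_ae_snd_le (μ := (lebX B).restrict {x | x.2 ≤ T}) (ae_restrict_mem hTm) hg.norm)
  refine continuous_iff_continuousAt.2 fun ψ => continuousAt_of_dominated
    (Filter.Eventually.of_forall fun φ =>
      (hg.measurable.indicator (measurableSet_region hc φ)).aestronglyMeasurable)
    (Filter.Eventually.of_forall fun φ => Filter.Eventually.of_forall fun x => ?_) hbound ?_
  · rw [norm_indicator_eq_indicator_norm]
    exact indicator_le_indicator_of_subset (hT φ) (fun _ => norm_nonneg _) x
  · filter_upwards [ae_lebX_snd_ne_zero, ae_cTransform_ne hc ψ (normaliser c ψ)] with x hx hne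
    have hmem (φ : C(Y, ℝ)) : x ∈ region c φ ↔ cTransform c φ x ≤ normaliser c φ :=
      le_levelMax_iff φ hc x.1 (normaliser c φ) (pos_iff_ne_zero.2 hx)
    have h1 : Continuous fun φ : C(Y, ℝ) => cTransform c φ x :=
      (LipschitzWith.of_le_add fun φ θ => by
        rw [dist_eq_norm]; exact cTransform_le_add_norm φ θ x).continuous
    have h2 := continuous_normaliser hc hB0
    rcases hne.lt_or_gt with hlt | hlt
    · refine continuousAt_const.congr (f := fun _ => g x) ?_
      filter_upwards [(isOpen_lt h1 h2).mem_nhds hlt] with φ hφ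
      exact (indicator_of_mem ((hmem φ).2 (le_of_lt hφ)) g).symm
    · refine continuousAt_const.congr (f := fun _ => 0) ?_
      filter_upwards [(isOpen_lt h2 h1).mem_nhds hlt] with φ hφ
      exact (indicator_of_notMem (fun h => not_le.2 hφ ((hmem φ).1 h)) g).symm

omit [CompactSpace B] in
lemma kantorovichReal_concave {μ : Measure (B × ℝ≥0)} (ν : Measure Y) [IsProbabilityMeasure ν]
    {ψ φ : C(Y, ℝ)} (hψ : Integrable (cTransform c ψ) μ) (hφ : Integrable (cTransform c φ) μ)
    {a : ℝ} (ha : 0 ≤ a) (ha' : a ≤ 1)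
    (hψφ : Integrable (cTransform c ((1 - a) • ψ + a • φ : C(Y, ℝ))) μ) :
    (1 - a) * kantorovichReal c μ ν ψ + a * kantorovichReal c μ ν φ ≤
      kantorovichReal c μ ν ((1 - a) • ψ + a • φ) := by
  have h1 := integral_mono ((hψ.const_mul (1 - a)).add (hφ.const_mul a)) hψφ
    fun x => cTransform_concave ψ φ ha ha' x
  rw [integral_add' (hψ.const_mul _) (hφ.const_mul _), integral_const_mul,
    integral_const_mul] at h1
  have h2 : ∫ y, ((1 - a) • ψ + a • φ : C(Y, ℝ)) y ∂ν =
      (1 - a) * ∫ y, ψ y ∂ν + a * ∫ y, φ y ∂ν := by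
    simp only [ContinuousMap.add_apply, ContinuousMap.smul_apply, smul_eq_mul]
    rw [integral_add ((integrable_potential ν ψ).const_mul _)
      ((integrable_potential ν φ).const_mul _), integral_const_mul, integral_const_mul]
  unfold kantorovichReal
  rw [h2]
  linarith

/-- A maximiser of the dual functional is a Kantorovich potential for its optimal surface. -/
lemma isKantorovichPotential_of_forall_dualReal_le (ν : Measure Y) [IsProbabilityMeasure ν]
    {ψ : C(Y, ℝ)} (hmax : ∀ φ, dualReal hc hB0 ν φ ≤ dualReal hc hB0 ν ψ) :
    IsKantorovichPotential c (sourceMeasure (optimalProb hc hB0 ψ)) ν ψ := by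
  intro φ
  rw [kantorovich_optimalProb, kantorovich_optimalProb, EReal.coe_le_coe_iff]
  let θ : ℝ → C(Y, ℝ) := fun a => (1 - a) • ψ + a • φ
  have hθ : Continuous θ := by fun_prop
  have hθ0 : θ 0 = ψ := by simp [θ]
  -- `a` moves only the surface, that of `θ a`, while the potential `χ` stays fixed.
  let K : C(Y, ℝ) → ℝ → ℝ :=
    fun χ a => kantorovichReal c (sourceMeasure (optimalProb hc hB0 (θ a))) ν χ
  have hK (χ) : Continuous (K χ) :=
    ((continuous_integral_optimalProb hc hB0 (continuous_cTransform χ hc)).comp hθ).add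
      continuous_const
  have hle : ∀ᶠ a in nhdsWithin (0 : ℝ) (Ioi 0), K φ a ≤ K ψ a := by
    filter_upwards [Ioo_mem_nhdsGT (zero_lt_one' ℝ)] with a ⟨ha, ha'⟩
    have hint (χ : C(Y, ℝ)) :=
      integrable_optimalProb hc hB0 (θ a) (continuous_cTransform χ hc)
    -- On the surface of `θ a`, concavity bounds the convex combination of `K ψ a` and `K φ a` by
    -- `G_ν(θ a)`, which is at most `G_ν(ψ) ≤ K ψ a`. Dividing by `a > 0` gives `K φ a ≤ K ψ a`, and
    -- `a → 0` returns to the surface of `ψ`.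
    have h1 := kantorovichReal_concave ν (hint ψ) (hint φ) ha.le ha'.le (hint (θ a))
    have h2 : dualReal hc hB0 ν (θ a) ≤ K ψ a :=
      (hmax _).trans (dualReal_le hc hB0 ν ψ _ (hint ψ))
    change (1 - a) * K ψ a + a * K φ a ≤ dualReal hc hB0 ν (θ a) at h1
    exact le_of_mul_le_mul_left (by linarith) ha
  have := le_of_tendsto_of_tendsto (((hK φ).tendsto 0).mono_left nhdsWithin_le_nhds)
    (((hK ψ).tendsto 0).mono_left nhdsWithin_le_nhds) hle
  simpa only [K, hθ0] using this

include hc in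
lemma dual_le_primal (ν : Measure Y) [IsProbabilityMeasure ν] (ψ : C(Y, ℝ)) (p : ProbAC B) :
    dual c ν ψ ≤ (primal c ν p : EReal) :=
  (iInf_le _ p).trans (kantorovich_le_transportCost hc _ ν ψ)

lemma primal_optimalProb_le_dual (ν : Measure Y) [IsProbabilityMeasure ν] {ψ : C(Y, ℝ)}
    (hψ : IsKantorovichPotential c (sourceMeasure (optimalProb hc hB0 ψ)) ν ψ) :
    (primal c ν (optimalProb hc hB0 ψ) : EReal) ≤ dual c ν ψ := by
  obtain ⟨T, hT⟩ := exists_ae_le_optimalProb hc hB0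
  refine (transportCost_le_kantorovich hc (hT ψ) ν hψ).trans_eq ?_
  rw [dual_eq_coe hc hB0, kantorovich_optimalProb, dualReal]

end Optimisation

end FreeSurface

end

theorem theorem3p13 (d : ℕ) (hd : 2 ≤ d)
    (B : Set (EuclideanSpace ℝ (Fin (d - 1)))) (hB : IsCompact B) (hB' : (interior B).Nonempty)
    (Y : Set (EuclideanSpace ℝ (Fin d))) (hY : IsCompact Y) (hY' : Y.Nonempty)
    (c : B × ℝ≥0 → Y → ℝ≥0) (hc : FreeSurface.IsAdmissibleCost c)
    (ν : Measure Y) (hν : IsProbabilityMeasure ν) :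
    -- the primal functional has a unique minimiser, and it has a continuous density
    (∃! p : FreeSurface.ProbAC B, FreeSurface.IsPrimalOptimal c ν p) ∧
    (∀ p : FreeSurface.ProbAC B, FreeSurface.IsPrimalOptimal c ν p →
      ∃ f : B → ℝ≥0, Continuous f ∧ p.HasDensity f) ∧
    -- strong duality: both extrema are attained, and they are the same finite number
    (∃ v : ℝ,
      IsLeast (range fun p : FreeSurface.ProbAC B => (FreeSurface.primal c ν p : EReal)) v ∧
      IsGreatest (range fun ψ : C(Y, ℝ) => FreeSurface.dual c ν ψ) v) ∧
    -- the surface `p_ψ` is well defined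
    (∀ ψ : C(Y, ℝ), ∃! τ : ℝ, FreeSurface.IsNormalising c ψ τ) ∧
    -- the optimality conditions
    (∀ (p : FreeSurface.ProbAC B) (ψ : C(Y, ℝ)),
      (FreeSurface.IsPrimalOptimal c ν p ∧ FreeSurface.IsDualOptimal c ν ψ) ↔
        (p.HasDensity (FreeSurface.optimalSurface c ψ) ∧
          FreeSurface.IsKantorovichPotential c (FreeSurface.sourceMeasure p) ν ψ)) := by
  open FreeSurface in
  have : CompactSpace B := isCompact_iff_compactSpace.1 hB
  have : CompactSpace Y := isCompact_iff_compactSpace.1 hY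
  have : Nonempty Y := hY'.to_subtype
  have hB0 : lebB B univ ≠ 0 := by
    rw [lebB_univ]
    exact (Measure.measure_pos_of_nonempty_interior volume hB').ne'
  obtain ⟨ψ, hψ⟩ := exists_dualReal_max hc hB0 ν
  have hpot := isKantorovichPotential_of_forall_dualReal_le hc hB0 ν hψ
  set p := optimalProb hc hB0 ψ with hp
  have hmax : IsDualOptimal c ν ψ := fun φ => by
    rw [dual_eq_coe hc hB0, dual_eq_coe hc hB0]
    exact EReal.coe_le_coe_iff.2 (hψ φ)
  have hattain {φ : C(Y, ℝ)}
      (hφ : IsKantorovichPotential c (sourceMeasure (optimalProb hc hB0 φ)) ν φ) :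
      (primal c ν (optimalProb hc hB0 φ) : EReal) = dual c ν φ :=
    le_antisymm (primal_optimalProb_le_dual hc hB0 ν hφ) (dual_le_primal hc ν φ _)
  have hopt {φ : C(Y, ℝ)}
      (hφ : IsKantorovichPotential c (sourceMeasure (optimalProb hc hB0 φ)) ν φ) :
      IsPrimalOptimal c ν (optimalProb hc hB0 φ) := fun p' => by
    rw [← EReal.coe_ennreal_le_coe_ennreal_iff, hattain hφ]
    exact dual_le_primal hc ν φ p'
  -- The pair `p`, `ψ` already closes the gap, so any two optimisers do.
  have hle {p' : ProbAC B} {φ : C(Y, ℝ)} (hp' : IsPrimalOptimal c ν p')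
      (hφ : IsDualOptimal c ν φ) : (primal c ν p' : EReal) ≤ dual c ν φ :=
    (EReal.coe_ennreal_le_coe_ennreal_iff.2 (hp' p)).trans ((hattain hpot).trans_le (hφ ψ))
  -- With no gap, `p'` attains the infimum defining the dual functional at `φ`, which only the
  -- surface of `φ` does.
  have huniq {p' : ProbAC B} {φ : C(Y, ℝ)} (hp' : IsPrimalOptimal c ν p')
      (hφ : IsDualOptimal c ν φ) : p' = optimalProb hc hB0 φ :=
    eq_optimalProb_of_kantorovich_le hc hB0 ν φ p'
      ((kantorovich_le_transportCost hc _ ν φ).trans (hle hp' hφ))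
  refine ⟨⟨p, hopt hpot, fun p' hp' => huniq hp' hmax⟩, fun p' hp' => ?_,
    ⟨dualReal hc hB0 ν ψ, ⟨⟨p, ?_⟩, ?_⟩, ⟨ψ, dual_eq_coe hc hB0 ν ψ⟩, ?_⟩, fun φ => ?_,
    fun p' φ => ⟨fun ⟨hp', hφ⟩ => ?_, fun ⟨hp', hφ⟩ => ?_⟩⟩
  · rw [huniq hp' hmax]
    exact ⟨_, continuous_optimalSurface hc ψ, hasDensity_optimalProb hc hB0 ψ⟩
  · exact (hattain hpot).trans (dual_eq_coe hc hB0 ν ψ)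
  · rintro _ ⟨p', rfl⟩
    rw [← dual_eq_coe]
    exact dual_le_primal hc ν ψ p'
  · rintro _ ⟨φ, rfl⟩
    rw [← dual_eq_coe]
    exact hmax φ
  · obtain ⟨τ, hτ⟩ := exists_isNormalising hc hB0 φ
    exact ⟨τ, hτ, fun τ' hτ' => hτ'.unique hc hτ⟩
  · refine ⟨huniq hp' hφ ▸ hasDensity_optimalProb hc hB0 φ, fun χ => ?_⟩
    -- Weak duality, no gap, and `p'` as a competitor in the dual infimum: `K(χ) ≤ F_ν(p') ≤ G_ν(φ)
    -- ≤ K(φ)`.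
    exact ((kantorovich_le_transportCost hc _ ν χ).trans (hle hp' hφ)).trans (iInf_le _ p')
  · obtain rfl : p' = optimalProb hc hB0 φ := Subtype.ext hp'
    refine ⟨hopt hφ, fun χ => ?_⟩
    exact (dual_le_primal hc ν χ _).trans (hattain hφ).le
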